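/- Let $n\ge 1$ and let $\sigma=\sigma_1\cdots\sigma_n$ be a permutation of $\{1,\dots,n\}$. An interval of $\sigma$ is a set of consecutive values $\{j,j+1,\dots,j+h\}$ of the form $\{\sigma_i,\sigma_{i+1},\dots,\sigma_{i+h}\}$ for some $i$. The interval poset $\tilde P(\sigma)$ is the set of non-empty intervals of $\sigma$ ordered by inclusion, together with the left-to-right order $\{\sigma_1\},\{\sigma_2\},\dots,\{\sigma_n\}$ of its minimal elements; the original interval poset $P(\sigma)$ is the same poset with its minimal elements ordered $\{1\},\{2\},\dots,\{n\}$. Two such plane posets are regarded as equal if there is an order isomorphism between them sending, for every $i$, the $i$-th minimal element of the first to the $i$-th minimal element of the second. A tree interval poset is an interval poset whose Hasse diagram is a tree. For every $n\ge 1$, let $t_n$ be the number of distinct tree interval posets with $n$ minimal elements, that is, of distinct plane posets $\tilde P(\sigma)$ that are trees, where $\sigma$ ranges over the permutations of $\{1,\dots,n\}$. Then $$t_n=\begin{cases}1 & \text{if } n=1,\\[4pt] \displaystyle\frac1n\left[\sum_{i=1}^{n-3}\ \sum_{k=1}^{\min\{i,\frac{n-i-1}{2}\}}\binom{n+i-1}{i}\binom{i}{k}\binom{n-i-k-2}{k-1}+\binom{2n-2}{n-1}\right]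 & \text{if } n>1,\end{cases}$$ where $k$ runs over the integers in the indicated range and empty sums are $0$. The same formula counts the distinct tree interval posets with $n$ minimal elements when the original interval posets $P(\sigma)$ are used instead of $\tilde P(\sigma)$. -/

import Mathlib

namespace IntervalPosets

/-- A set `I` of values is an interval of the permutation `σ` of `{0, …, n-1}` when it is a set of
consecutive values which is the image under `σ` of a set of consecutive positions. -/
def IsInterval {n : ℕ} (σ : Equiv.Perm (Fin n)) (I : Finset (Fin n)) : Prop :=
  (∃ a b : Fin n, I = Finset.Icc a b) ∧
    ∃ c d : Fin n, I = (Finset.Icc c d).map σ.toEmbedding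

/-- The non-empty intervals of `σ`, ordered by inclusion. -/
abbrev NonemptyInterval {n : ℕ} (σ : Equiv.Perm (Fin n)) : Type :=
  {I : Finset (Fin n) // I.Nonempty ∧ IsInterval σ I}

/-- The trivial interval `{j}` of `σ`. -/
def singletonInterval {n : ℕ} (σ : Equiv.Perm (Fin n)) (j : Fin n) : NonemptyInterval σ :=
  ⟨{j}, Finset.singleton_nonempty j, ⟨j, j, by simp⟩, ⟨σ.symm j, σ.symm j, by simp⟩⟩

theorem singletonInterval_injective {n : ℕ} (σ : Equiv.Perm (Fin n)) :
    Function.Injective (singletonInterval σ) := by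
  intro i j h
  exact Finset.singleton_injective (congrArg Subtype.val h)

theorem isMin_iff {n : ℕ} (σ : Equiv.Perm (Fin n)) (I : NonemptyInterval σ) :
    IsMin I ↔ ∃ j, singletonInterval σ j = I := by
  constructor
  · intro h
    obtain ⟨j, hj⟩ := I.2.1
    have hle : singletonInterval σ j ≤ I := Finset.singleton_subset_iff.2 hj
    exact ⟨j, le_antisymm hle (h hle)⟩
  · rintro ⟨j, rfl⟩ J hJ
    have hJ' : J.1 ⊆ {j} := hJ
    have h2 : J.1 = {j} := (Finset.subset_singleton_iff.1 hJ').resolve_left J.2.1.ne_empty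
    exact (show ({j} : Finset (Fin n)) ⊆ J.1 from h2.ge)

/-- A poset with exactly `n` minimal elements, together with the order in which these minimal
elements appear from left to right: `leaf i` is the `i`-th one. -/
structure PlanePoset (n : ℕ) : Type 1 where
  carrier : Type
  order : PartialOrder carrier
  leaf : Fin n → carrier
  leaf_injective : Function.Injective leaf
  isMin_iff_leaf : ∀ x : carrier, IsMin x ↔ ∃ i, leaf i = x

instance {n : ℕ} (P : PlanePoset n) : PartialOrder P.carrier := P.order

/-- Two plane posets are the same when there is an isomorphism of posets between them which
respects the left-to-right order of the minimal elements. -/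
def PlanePoset.Same {n : ℕ} (P Q : PlanePoset n) : Prop :=
  ∃ e : P.carrier ≃o Q.carrier, ∀ i, e (P.leaf i) = Q.leaf i

instance PlanePoset.setoid (n : ℕ) : Setoid (PlanePoset n) where
  r := PlanePoset.Same
  iseqv :=
    { refl := fun P => ⟨OrderIso.refl P.carrier, fun _ => rfl⟩
      symm := fun {P Q} h => by
        obtain ⟨e, he⟩ := h
        exact ⟨e.symm, fun i => by rw [← he i, OrderIso.symm_apply_apply]⟩
      trans := fun {P Q R} h₁ h₂ => by
        obtain ⟨e, he⟩ := h₁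
        obtain ⟨f, hf⟩ := h₂
        exact ⟨e.trans f, fun i => by rw [OrderIso.trans_apply, he i, hf i]⟩ }

/-- A plane poset is a tree when its Hasse diagram is a tree. -/
def PlanePoset.IsTree {n : ℕ} (P : PlanePoset n) : Prop :=
  (SimpleGraph.hasse P.carrier).IsTree

/-- The original interval poset `P(σ)`: the non-empty intervals of `σ` under inclusion, with the
minimal elements in the left-to-right order of their values. -/
def originalIntervalPoset {n : ℕ} (σ : Equiv.Perm (Fin n)) : PlanePoset n where
  carrier := NonemptyInterval σ
  order := inferInstance
  leaf := fun j => singletonInterval σ j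
  leaf_injective := singletonInterval_injective σ
  isMin_iff_leaf := isMin_iff σ

/-- The modified interval poset `P̃(σ)`: the non-empty intervals of `σ` under inclusion, with the
minimal elements `{σ 0}, {σ 1}, …` in this order from left to right. -/
def modifiedIntervalPoset {n : ℕ} (σ : Equiv.Perm (Fin n)) : PlanePoset n where
  carrier := NonemptyInterval σ
  order := inferInstance
  leaf := fun i => singletonInterval σ (σ i)
  leaf_injective := (singletonInterval_injective σ).comp σ.injective
  isMin_iff_leaf := fun I => (isMin_iff σ I).trans
    (σ.surjective.exists (p := fun j => singletonInterval σ j = I))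

/-- The tree interval posets with `n` minimal elements, as plane posets up to isomorphism, for the
original embedding of interval posets. -/
def originalTreeIntervalPosets (n : ℕ) : Set (Quotient (PlanePoset.setoid n)) :=
  {c | ∃ σ : Equiv.Perm (Fin n),
    (originalIntervalPoset σ).IsTree ∧ c = ⟦originalIntervalPoset σ⟧}

/-- The tree interval posets with `n` minimal elements, as plane posets up to isomorphism, for the
modified embedding of interval posets. -/
def treeIntervalPosets (n : ℕ) : Set (Quotient (PlanePoset.setoid n)) :=
  {c | ∃ σ : Equiv.Perm (Fin n),
    (modifiedIntervalPoset σ).IsTree ∧ c = ⟦modifiedIntervalPoset σ⟧}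

/-- The closed formula. In its range `1 ≤ i ≤ n - 3`, `1 ≤ k ≤ min i ((n - i - 1) / 2)` no
subtraction truncates, and rounding `(n - i - 1) / 2` down does not change the range of `k`. -/
def treeFormula (n : ℕ) : ℚ :=
  if n = 1 then 1
  else (1 / (n : ℚ)) *
    ((∑ i ∈ Finset.Icc 1 (n - 3), ∑ k ∈ Finset.Icc 1 (min i ((n - i - 1) / 2)),
        ((n + i - 1).choose i : ℚ) * (i.choose k : ℚ) * ((n - i - k - 2).choose (k - 1) : ℚ)) +
      ((2 * n - 2).choose (n - 1) : ℚ))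

end IntervalPosets

/-! An interval of `σ` is recorded by its block of positions `[c, d)`. An isomorphism that respects
the minimal elements in the order `σ 0, σ 1, …` preserves these blocks, so the plane poset and the
family of blocks determine each other (`same_iff`). The Hasse diagram is a tree exactly when the
blocks form a laminar family (`isTree_iff_laminar`), and the poset is then a plane tree whose leaves
are the positions.

The trees that occur are those whose internal nodes have two or at least four children. Three
children are impossible: among three consecutive intervals whose union is an interval, two
neighbours merge into an interval (`blockFamily_three`). Conversely every such tree is built from
the leaves by inflation: a node with at least four children inflates a simple permutation, and a
node with two children inflates `12`, after reversing the values inside a child where needed so that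
no interval crosses the cut (`PlaneForest.isChain_realizes`). Passing from `σ` to its inverse
exchanges positions and values, which settles the original embedding.

Counting is done for forests with any number of trees, as the trees alone satisfy no simple linear
recurrence. Undoing the last construction step gives such a recurrence
(`ncard_planeForests_succ_succ`). With `A` the sum of `x ^ (a - 1)` over the arities `a`, its
solution is the Lagrange inversion formula for powers of `1 / (1 - A)`, checked by induction
(`ncard_planeForests`). Expanding the coefficient for one tree gives the closed formula. -/

namespace IntervalPosets

/-! ### Plane forests encoded by the blocks of leaves below their nodes. -/

/-- The possible numbers of children of an internal node of a tree interval poset. -/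
def IsArity (a : ℕ) : Prop := a = 2 ∨ 4 ≤ a

instance : DecidablePred IsArity := fun a => inferInstanceAs (Decidable (a = 2 ∨ 4 ≤ a))

/-- `PlaneForest s F n` says that `F` is the family of the sets of leaves, written as blocks
`[c, d)`, below the nodes of a plane forest with leaves `0, …, n - 1` in which every internal node
has two or at least four children; `s` lists the first leaves of its trees from right to left. -/
inductive PlaneForest : List ℕ → Finset (ℕ × ℕ) → ℕ → Prop
  | nil : PlaneForest [] ∅ 0
  | leaf {s : List ℕ} {F : Finset (ℕ × ℕ)} {n : ℕ} :
      PlaneForest s F n → PlaneForest (n :: s) (insert (n, n + 1) F) (n + 1)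
  | node {l : List ℕ} {c : ℕ} {s : List ℕ} {F : Finset (ℕ × ℕ)} {n : ℕ} :
      PlaneForest (l ++ c :: s) F n → IsArity (l.length + 1) →
        PlaneForest (c :: s) (insert (c, n) F) n

theorem IsArity.two_le {a : ℕ} (h : IsArity a) : 2 ≤ a := by
  rcases h with h | h <;> omega

namespace PlaneForest

variable {s : List ℕ} {F : Finset (ℕ × ℕ)} {n : ℕ}

/-- Consecutive entries of `n :: s` are the right and left ends of the successive trees; putting `n`
in front treats the rightmost tree like the others. -/
theorem bounds (h : PlaneForest s F n) :
    (n :: s).IsChain (· > ·) ∧ ∀ c d, (c, d) ∈ F → c < d ∧ d ≤ n := by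
  induction h with
  | nil => simp
  | @leaf s F n h ih =>
    refine ⟨List.isChain_cons_cons.2 ⟨by simp, ih.1⟩, ?_⟩
    intro c d hcd
    rcases Finset.mem_insert.1 hcd with h | h
    · simp only [Prod.mk.injEq] at h
      omega
    · have := ih.2 c d h
      omega
  | @node l c s F n h ha ih =>
    have hp := List.isChain_iff_pairwise.1 ih.1
    have hcn : c < n := List.rel_of_pairwise_cons hp (by simp)
    refine ⟨?_, ?_⟩
    · rw [List.isChain_iff_pairwise]
      exact hp.sublist (List.Sublist.cons_cons _ (List.sublist_append_right _ _))
    · intro x d hcd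
      rcases Finset.mem_insert.1 hcd with h | h
      · simp only [Prod.mk.injEq] at h
        omega
      · exact ih.2 x d h

theorem lt_of_mem_starts (h : PlaneForest s F n) {b : ℕ} (hb : b ∈ s) : b < n :=
  List.rel_of_pairwise_cons (List.isChain_iff_pairwise.1 h.bounds.1) hb

theorem pairwise_starts (h : PlaneForest s F n) : s.Pairwise (· > ·) :=
  (List.isChain_iff_pairwise.1 h.bounds.1).of_cons

theorem isChain_mem (h : PlaneForest s F n) : (n :: s).IsChain (fun q p => (p, q) ∈ F) := by
  induction h with
  | nil => simp
  | leaf h ih =>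
    exact List.isChain_cons_cons.2 ⟨by simp, ih.imp fun _ _ h => Finset.mem_insert_of_mem h⟩
  | @node l c s F n h ha ih =>
    refine List.isChain_cons_cons.2 ⟨by simp, ?_⟩
    exact ((List.isChain_append.1 ih.tail).2.1).imp fun _ _ h => Finset.mem_insert_of_mem h

theorem le_or_le_of_mem (h : PlaneForest s F n) :
    ∀ b ∈ s, ∀ c d, (c, d) ∈ F → b ≤ c ∨ d ≤ b := by
  induction h with
  | nil => simp
  | @leaf s F n h ih =>
    intro b hb c d hcd
    have hbn : b ≤ n := by
      rcases List.mem_cons.1 hb with hb | hb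
      · exact hb.le
      · exact (h.lt_of_mem_starts hb).le
    rcases Finset.mem_insert.1 hcd with hcd | hcd
    · simp only [Prod.mk.injEq] at hcd
      omega
    · rcases List.mem_cons.1 hb with hb | hb
      · exact Or.inr (hb ▸ (h.bounds.2 c d hcd).2)
      · exact ih b hb c d hcd
  | @node l c s F n h ha ih =>
    intro b hb x d hcd
    rcases Finset.mem_insert.1 hcd with hcd | hcd
    · simp only [Prod.mk.injEq] at hcd
      rcases List.mem_cons.1 hb with rfl | hb
      · omega
      · have := List.rel_of_pairwise_cons (List.pairwise_append.1 h.pairwise_starts).2.1 hb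
        omega
    · exact ih b (List.mem_append_right l hb) x d hcd

/-- Together with `isChain_mem` this says that the trees tile `[0, n)`. The empty forest fits in
because then `n = 0`. -/
theorem getLast_starts (h : PlaneForest s F n) : (n :: s).getLast (by simp) = 0 := by
  induction h with
  | nil => rfl
  | leaf h ih => simpa using ih
  | @node l c s F n h ha ih => simpa using ih

theorem exists_block {R : ℕ → ℕ → Prop} : ∀ {s : List ℕ} {n : ℕ}, (n :: s).IsChain R →
    (n :: s).getLast (by simp) = 0 → ∀ x < n, ∃ p ∈ s, ∃ q ∈ n :: s, R q p ∧ p ≤ x ∧ x < q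
  | [], n, _, hl, x, hx => by
    simp at hl
    omega
  | b :: s, n, hc, hl, x, hx => by
    rw [List.isChain_cons_cons] at hc
    by_cases hb : b ≤ x
    · exact ⟨b, by simp, n, by simp, hc.1, hb, hx⟩
    · obtain ⟨p, hp, q, hq, h⟩ := exists_block hc.2 (by simpa using hl) x (by omega)
      exact ⟨p, List.mem_cons_of_mem _ hp, q, List.mem_cons_of_mem _ hq, h⟩

/-- A position strictly inside a tree is straddled by the block of its root, and a first leaf of a
tree is straddled by nothing. Hence `F` alone determines `s`. -/
theorem mem_starts_iff (h : PlaneForest s F n) (b : ℕ) :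
    b ∈ s ↔ b < n ∧ ∀ c d, (c, d) ∈ F → b ≤ c ∨ d ≤ b := by
  refine ⟨fun hb => ⟨h.lt_of_mem_starts hb, h.le_or_le_of_mem b hb⟩, fun ⟨hb, hF⟩ => ?_⟩
  obtain ⟨p, hp, q, -, hpq, h1, h2⟩ := exists_block h.isChain_mem h.getLast_starts b hb
  have := hF p q hpq
  rwa [show b = p by omega]

theorem starts_unique {s' : List ℕ} (h : PlaneForest s F n) (h' : PlaneForest s' F n) :
    s = s' := by
  have hn : s.Nodup := h.pairwise_starts.imp fun h => (ne_of_gt h)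
  have hn' : s'.Nodup := h'.pairwise_starts.imp fun h => (ne_of_gt h)
  refine List.Perm.eq_of_pairwise (le := (· > ·)) (fun a b _ _ h1 h2 => ?_) h.pairwise_starts
    h'.pairwise_starts ((List.perm_ext_iff_of_nodup hn hn').2 fun b => ?_)
  · exact absurd h1 (not_lt_of_gt h2)
  · rw [h.mem_starts_iff, h'.mem_starts_iff]

theorem length_starts_le (h : PlaneForest s F n) : s.length ≤ n := by
  induction h with
  | nil => simp
  | leaf h ih => simpa using ih
  | node h ha ih =>
    simp only [List.length_append, List.length_cons] at ih ⊢
    omega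

theorem laminar (h : PlaneForest s F n) :
    ∀ c d c' d', (c, d) ∈ F → (c', d') ∈ F → c < c' → c' < d → d' ≤ d := by
  induction h with
  | nil => simp
  | @leaf s F n h ih =>
    intro c d c' d' h1 h2 h3 h4
    rcases Finset.mem_insert.1 h1 with h1 | h1 <;> rcases Finset.mem_insert.1 h2 with h2 | h2
    · simp only [Prod.mk.injEq] at h1 h2
      omega
    · have := h.bounds.2 _ _ h2
      simp only [Prod.mk.injEq] at h1
      omega
    · have := h.bounds.2 _ _ h1
      simp only [Prod.mk.injEq] at h2
      omega
    · exact ih c d c' d' h1 h2 h3 h4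
  | @node l b s F n h ha ih =>
    intro c d c' d' h1 h2 h3 h4
    rcases Finset.mem_insert.1 h1 with h1 | h1 <;> rcases Finset.mem_insert.1 h2 with h2 | h2
    · simp only [Prod.mk.injEq] at h1 h2
      omega
    · have := h.bounds.2 _ _ h2
      simp only [Prod.mk.injEq] at h1
      omega
    · have := h.le_or_le_of_mem b (by simp) _ _ h1
      simp only [Prod.mk.injEq] at h2
      omega
    · exact ih c d c' d' h1 h2 h3 h4

/-- At least two trees are joined, so some start lies strictly between `c` and `n` and would be
straddled. Erasing the new root block therefore recovers the old family. -/
theorem notMem_of_node {l : List ℕ} {c : ℕ} (h : PlaneForest (l ++ c :: s) F n)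
    (ha : IsArity (l.length + 1)) : (c, n) ∉ F := by
  intro hc
  have h2 := ha.two_le
  obtain ⟨b, hb⟩ := List.exists_mem_of_length_pos (l := l) (by omega)
  have h3 := h.le_or_le_of_mem b (by simp [hb]) c n hc
  have h4 := (List.pairwise_append.1 h.pairwise_starts).2.2 b hb c (by simp)
  have h5 := h.lt_of_mem_starts (b := b) (by simp [hb])
  omega

end PlaneForest

/-! ### The recurrence for the number of plane forests. -/

/-- The plane forests with `m` trees and `n` leaves. -/
def planeForests (m n : ℕ) : Set (List ℕ × Finset (ℕ × ℕ)) :=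
  {p | PlaneForest p.1 p.2 n ∧ p.1.length = m}

theorem finite_planeForests (m n : ℕ) : (planeForests m n).Finite := by
  refine Set.Finite.of_injOn (f := Prod.snd)
    (t := ((Finset.range (n + 1) ×ˢ Finset.range (n + 1)).powerset : Set (Finset (ℕ × ℕ))))
    ?_ ?_ (Finset.finite_toSet _)
  · rintro ⟨s, F⟩ ⟨h, -⟩
    simp only [Finset.coe_powerset, Set.mem_preimage, Set.mem_powerset_iff, Finset.coe_subset]
    rintro ⟨c, d⟩ hcd
    have := h.bounds.2 c d hcd
    simp only [Finset.mem_product, Finset.mem_range]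
    omega
  · rintro ⟨s, F⟩ ⟨h, -⟩ ⟨s', F'⟩ ⟨h', -⟩ (rfl : F = F')
    exact Prod.ext (h.starts_unique h') rfl

theorem planeForests_eq_empty {m n : ℕ} (h : n < m) : planeForests m n = ∅ := by
  ext ⟨s, F⟩
  simp only [Set.mem_empty_iff_false, iff_false]
  rintro ⟨h1, h2⟩
  exact absurd (h2 ▸ h1.length_starts_le) (not_le_of_gt h)

theorem planeForests_zero_zero : planeForests 0 0 = {([], ∅)} := by
  ext ⟨s, F⟩
  simp only [Set.mem_singleton_iff, Prod.mk.injEq]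
  constructor
  · rintro ⟨h1, h2⟩
    rw [List.length_eq_zero_iff] at h2
    refine ⟨h2, ?_⟩
    rw [Finset.eq_empty_iff_forall_notMem]
    rintro ⟨c, d⟩ hcd
    have := h1.bounds.2 c d hcd
    omega
  · rintro ⟨rfl, rfl⟩
    exact ⟨.nil, rfl⟩

theorem planeForests_zero_succ (n : ℕ) : planeForests 0 (n + 1) = ∅ := by
  ext ⟨s, F⟩
  simp only [Set.mem_empty_iff_false, iff_false]
  rintro ⟨h1, h2⟩
  rw [List.length_eq_zero_iff] at h2
  simp only at h2 h1
  subst h2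
  simpa using h1.getLast_starts

/-- Adding a new rightmost tree that consists of a single leaf. -/
def addLeaf (n : ℕ) (p : List ℕ × Finset (ℕ × ℕ)) : List ℕ × Finset (ℕ × ℕ) :=
  (n :: p.1, insert (n, n + 1) p.2)

/-- Joining the `a` rightmost trees under a new root. -/
def joinTrees (n a : ℕ) (p : List ℕ × Finset (ℕ × ℕ)) : List ℕ × Finset (ℕ × ℕ) :=
  (p.1.drop (a - 1), insert ((p.1.drop (a - 1)).headD 0, n) p.2)

theorem exists_append_of_length {s : List ℕ} {m a : ℕ} (ha : 1 ≤ a) (h : s.length = m + a) :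
    ∃ l c t, s = l ++ c :: t ∧ l.length + 1 = a ∧ t.length = m := by
  have hl : (s.drop (a - 1)).length = m + 1 := by
    rw [List.length_drop]
    omega
  obtain ⟨c, t, hct⟩ := List.exists_cons_of_length_eq_add_one hl
  refine ⟨s.take (a - 1), c, t, ?_, ?_, ?_⟩
  · rw [← hct, List.take_append_drop]
  · rw [List.length_take]
    omega
  · rw [hct] at hl
    simpa using hl

theorem joinTrees_append {n a c : ℕ} {l t : List ℕ} {F : Finset (ℕ × ℕ)} (h : l.length + 1 = a) :
    joinTrees n a (l ++ c :: t, F) = (c :: t, insert (c, n) F) := by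
  subst h
  simp [joinTrees]

theorem planeForests_succ_succ (m n : ℕ) :
    planeForests (m + 1) (n + 1) = addLeaf n '' planeForests m n ∪
      ⋃ a ∈ {a | a ∈ Finset.range (n + 2) ∧ IsArity a},
        joinTrees (n + 1) a '' planeForests (m + a) (n + 1) := by
  ext ⟨s, F⟩
  constructor
  · rintro ⟨h1, h2⟩
    simp only at h1 h2
    generalize hN : n + 1 = N at h1
    cases h1 with
    | nil => omega
    | @leaf s F n' h =>
      obtain rfl : n = n' := by omega
      exact Or.inl ⟨(s, F), ⟨h, by simpa using h2⟩, rfl⟩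
    | @node l c s F _ h ha =>
      subst hN
      have hlen := h.length_starts_le
      refine Or.inr (Set.mem_biUnion (x := l.length + 1) ⟨?_, ha⟩
        ⟨(l ++ c :: s, F), ⟨h, ?_⟩, joinTrees_append rfl⟩)
      · simp only [List.length_append, List.length_cons, Finset.mem_range] at hlen ⊢
        omega
      · simp only [List.length_append, List.length_cons] at h2 ⊢
        omega
  · rintro (⟨⟨s, F⟩, ⟨h1, h2⟩, h⟩ | h)
    · rw [← h]
      exact ⟨.leaf h1, by simpa [addLeaf] using h2⟩
    · obtain ⟨a, ⟨-, ha⟩, ⟨s', F'⟩, ⟨h1, h2⟩, h⟩ := Set.mem_iUnion₂.1 h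
      obtain ⟨l, c, t, rfl, hl, ht⟩ := exists_append_of_length (by have := ha.two_le; omega) h2
      rw [← h, joinTrees_append hl]
      exact ⟨.node h1 (hl ▸ ha), by simp [ht]⟩

theorem injOn_addLeaf (m n : ℕ) : Set.InjOn (addLeaf n) (planeForests m n) := by
  rintro ⟨s, F⟩ ⟨h, -⟩ ⟨s', F'⟩ ⟨h', -⟩ heq
  simp only [addLeaf, Prod.mk.injEq, List.cons.injEq, true_and] at heq
  have hF : (n, n + 1) ∉ F := fun hn => by have := h.bounds.2 _ _ hn; omega
  have hF' : (n, n + 1) ∉ F' := fun hn => by have := h'.bounds.2 _ _ hn; omega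
  have := congrArg (fun G => G.erase (n, n + 1)) heq.2
  simp only [Finset.erase_insert hF, Finset.erase_insert hF'] at this
  rw [heq.1, this]

/-- Erasing the root block recovers the old family, and the family recovers the starts. Allowing `a
≠ a'` yields both injectivity for each arity and disjointness of the images for different arities.
-/
theorem joinTrees_inj {m n a a' : ℕ} (ha : IsArity a) (ha' : IsArity a')
    {p p' : List ℕ × Finset (ℕ × ℕ)} (hp : p ∈ planeForests (m + a) n)
    (hp' : p' ∈ planeForests (m + a') n) (h : joinTrees n a p = joinTrees n a' p') : p = p' := by
  obtain ⟨s, F⟩ := p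
  obtain ⟨s', F'⟩ := p'
  obtain ⟨h1, h2⟩ := hp
  obtain ⟨h1', h2'⟩ := hp'
  obtain ⟨l, c, t, rfl, hl, ht⟩ := exists_append_of_length (by have := ha.two_le; omega) h2
  obtain ⟨l', c', t', rfl, hl', ht'⟩ := exists_append_of_length (by have := ha'.two_le; omega) h2'
  rw [joinTrees_append hl, joinTrees_append hl'] at h
  simp only [Prod.mk.injEq, List.cons.injEq] at h h1 h1'
  obtain ⟨⟨rfl, rfl⟩, h⟩ := h
  have hF := h1.notMem_of_node (hl ▸ ha)
  have hF' := h1'.notMem_of_node (hl' ▸ ha')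
  have := congrArg (fun G => G.erase (c, n)) h
  simp only [Finset.erase_insert hF, Finset.erase_insert hF'] at this
  subst this
  rw [h1.starts_unique h1']

theorem ncard_planeForests_succ_succ (m n : ℕ) :
    (planeForests (m + 1) (n + 1)).ncard = (planeForests m n).ncard +
      ∑ a ∈ Finset.range (n + 2) with IsArity a, (planeForests (m + a) (n + 1)).ncard := by
  have hfin : {a | a ∈ Finset.range (n + 2) ∧ IsArity a}.Finite :=
    (Finset.finite_toSet (Finset.range (n + 2))).subset fun a ha => ha.1
  rw [planeForests_succ_succ, Set.ncard_union_eq ?_ ((finite_planeForests _ _).image _)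
    (hfin.biUnion fun a _ => (finite_planeForests _ _).image _), (injOn_addLeaf m n).ncard_image,
    Set.Finite.ncard_biUnion hfin]
  · congr 1
    rw [finsum_mem_eq_finite_toFinset_sum _ hfin]
    refine Finset.sum_congr (by ext; simp) fun a ha => ?_
    refine Set.InjOn.ncard_image fun p hp p' hp' h => ?_
    have ha : IsArity a := (Finset.mem_filter.1 ha).2
    exact joinTrees_inj ha ha hp hp' h
  · exact fun a _ => (finite_planeForests _ _).image _
  · intro a ha a' ha' hne
    refine Set.disjoint_left.2 ?_
    rintro _ ⟨p, hp, rfl⟩ ⟨p', hp', h⟩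
    have := joinTrees_inj ha'.2 ha.2 hp' hp h
    subst this
    have h1 := hp.2
    have h2 := hp'.2
    omega
  -- A last tree that is a single leaf starts at `n`, whereas a joined tree has a further start
  -- strictly between its first leaf and `n + 1`.
  · refine Set.disjoint_left.2 ?_
    rintro _ ⟨⟨s, F⟩, ⟨h1, h2⟩, rfl⟩ h
    obtain ⟨a, ⟨-, ha⟩, ⟨s', F'⟩, ⟨h1', h2'⟩, h⟩ := Set.mem_iUnion₂.1 h
    obtain ⟨l, c, t, rfl, hl, ht⟩ := exists_append_of_length (by have := ha.two_le; omega) h2'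
    rw [joinTrees_append hl] at h
    simp only [addLeaf, Prod.mk.injEq, List.cons.injEq] at h
    have h3 := h1'.length_starts_le
    have h4 := ha.two_le
    obtain ⟨b, hb⟩ := List.exists_mem_of_length_pos (l := l) (by omega)
    have h5 := (List.pairwise_append.1 h1'.pairwise_starts).2.2 b hb c (by simp)
    have h6 := h1'.lt_of_mem_starts (b := b) (by simp [hb])
    omega

/-! ### From laminar families to plane forests. -/

/-- A laminar family of blocks of `[0, n)` which contains all singletons, and in which no block is
the union of three consecutive maximal proper subblocks, comes from a plane forest. -/
theorem exists_planeForest (n : ℕ) (R : ℕ → ℕ → Prop) (hlt : ∀ c d, R c d → c < d)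
    (hone : ∀ c < n, R c (c + 1))
    (hlam : ∀ c d c' d', R c d → R c' d' → c < c' → c' < d → d' ≤ d)
    (hthree : ∀ c e f d, d ≤ n → c < e → e < f → f < d → R c e → R e f → R f d → R c d →
      R c f ∨ R e d) :
    ∃ s F, PlaneForest s F n ∧ ∀ c d, (c, d) ∈ F ↔ R c d ∧ d ≤ n := by
  induction n with
  | zero => exact ⟨[], ∅, .nil, fun c d => by simpa using fun h => by have := hlt c d h; omega⟩
  | succ n ih =>
    obtain ⟨s, F, hF, hR⟩ := ih (fun c hc => hone c (by omega))
      fun c e f d hd => hthree c e f d (by omega)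
    -- The blocks ending at `n + 1` are added from the shortest to the longest; after stage `k`
    -- those starting at `n - k` or later are present.
    suffices H : ∀ k ≤ n, ∃ s F, PlaneForest s F (n + 1) ∧
        ∀ c d, (c, d) ∈ F ↔ R c d ∧ (d ≤ n ∨ d = n + 1 ∧ n - k ≤ c) by
      obtain ⟨s, F, hF, hR⟩ := H n le_rfl
      refine ⟨s, F, hF, fun c d => ?_⟩
      rw [hR]
      exact and_congr_right fun _ => by omega
    intro k
    induction k with
    | zero =>
      intro _
      refine ⟨_, _, .leaf hF, fun c d => ?_⟩
      rw [Finset.mem_insert, hR, Prod.mk.injEq]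
      constructor
      · rintro (⟨rfl, rfl⟩ | ⟨h1, h2⟩)
        · exact ⟨hone c (by omega), by omega⟩
        · exact ⟨h1, Or.inl h2⟩
      · rintro ⟨h1, h2⟩
        have := hlt c d h1
        rcases h2 with h2 | h2
        · exact Or.inr ⟨h1, h2⟩
        · exact Or.inl (by omega)
    | succ k ihk =>
      intro hk
      obtain ⟨s, F, hF, hR⟩ := ihk (by omega)
      by_cases hc : R (n - (k + 1)) (n + 1)
      · generalize hc0 : n - (k + 1) = c0 at hc
        have hk1 : n - k = c0 + 1 := by omega
        rw [hk1] at hR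
        have hnot : (c0, n + 1) ∉ F := fun h => by have := ((hR _ _).1 h).2; omega
        obtain ⟨p, hp, q, hq, hpq, h1, h2⟩ :=
          PlaneForest.exists_block hF.isChain_mem hF.getLast_starts c0 (by omega)
        -- If `c0` were strictly inside a tree, laminarity would force that tree to reach `n + 1`,
        -- but no block starting before `c0 + 1` and ending there has been added yet.
        have hc0s : c0 ∈ s := by
          rcases h1.eq_or_lt with rfl | h1
          · exact hp
          · have h3 := hlam p q c0 (n + 1) ((hR _ _).1 hpq).1 hc h1 h2
            have h4 := ((hR _ _).1 hpq).2
            omega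
        obtain ⟨l, t, rfl⟩ := List.append_of_mem hc0s
        refine ⟨_, _, .node hF ?_, fun c d => ?_⟩
        -- The arity is the number of trees from `c0` on. One tree would mean that the block is
        -- already present; with three, `hthree` yields a block straddling a start.
        · have hch := hF.isChain_mem
          match l, hch with
          | [], hch => exact absurd (List.isChain_cons_cons.1 hch).1 hnot
          | [e], _ => exact Or.inl rfl
          | [f, e], hch =>
            exfalso
            simp only [List.cons_append, List.nil_append, List.isChain_cons_cons] at hch
            obtain ⟨h1, h2, h3, -⟩ := hch
            have b1 := hF.bounds.2 _ _ h1
            have b2 := hF.bounds.2 _ _ h2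
            have b3 := hF.bounds.2 _ _ h3
            rcases hthree c0 e f (n + 1) le_rfl b3.1 b2.1 b1.1 ((hR _ _).1 h3).1 ((hR _ _).1 h2).1
              ((hR _ _).1 h1).1 hc with h | h
            · have := hF.le_or_le_of_mem e (by simp) c0 f ((hR _ _).2 ⟨h, by omega⟩)
              omega
            · have := hF.le_or_le_of_mem f (by simp) e (n + 1) ((hR _ _).2 ⟨h, by omega⟩)
              omega
          | _ :: _ :: _ :: _, _ => exact Or.inr (by simp)
        · rw [Finset.mem_insert, hR, Prod.mk.injEq]
          constructor
          · rintro (⟨rfl, rfl⟩ | ⟨h1, h2⟩)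
            · exact ⟨hc, by omega⟩
            · exact ⟨h1, by omega⟩
          · rintro ⟨h1, h2⟩
            by_cases h : c = c0 ∧ d = n + 1
            · exact Or.inl h
            · exact Or.inr ⟨h1, by omega⟩
      · refine ⟨s, F, hF, fun c d => ?_⟩
        rw [hR]
        refine and_congr_right fun h => ?_
        have : ¬ (c = n - (k + 1) ∧ d = n + 1) := by
          rintro ⟨rfl, rfl⟩
          exact hc h
        omega

/-! ### Realizing plane trees by inflation. -/

/-- The values of `v` on the block `[c, d)` form an interval among its values on `[p, q)`. -/
def BlockConvex (v : ℕ → ℤ) (p q c d : ℕ) : Prop :=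
  ∀ x y z, c ≤ x → x < d → c ≤ y → y < d → p ≤ z → z < q → v x ≤ v z → v z ≤ v y → c ≤ z ∧ z < d

/-- The blocks contained in `[p, q)` that belong to `F` are the intervals of `v` on `[p, q)`. -/
structure Realizes (F : Finset (ℕ × ℕ)) (p q : ℕ) (v : ℕ → ℤ) : Prop where
  inj : Set.InjOn v (Set.Ico p q)
  convex_iff : ∀ c d, p ≤ c → c < d → d ≤ q → (BlockConvex v p q c d ↔ (c, d) ∈ F)

theorem BlockConvex.neg {v : ℕ → ℤ} {p q c d : ℕ} (h : BlockConvex v p q c d) :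
    BlockConvex (-v) p q c d := fun x y z hx hx' hy hy' hz hz' h1 h2 =>
  h y x z hy hy' hx hx' hz hz' (neg_le_neg_iff.1 h2) (neg_le_neg_iff.1 h1)

theorem Realizes.neg {F : Finset (ℕ × ℕ)} {p q : ℕ} {v : ℕ → ℤ} (h : Realizes F p q v) :
    Realizes F p q (-v) where
  inj := fun x hx y hy hxy => h.inj hx hy (neg_inj.1 hxy)
  convex_iff := fun c d hc hcd hd => by
    rw [← h.convex_iff c d hc hcd hd]
    exact ⟨fun h => by simpa using h.neg, fun h => h.neg⟩

/-- Reversing the values keeps the intervals. This normalization is what prevents an increasing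
juxtaposition of two blocks from creating new intervals. -/
theorem Realizes.exists_last_le_first {F : Finset (ℕ × ℕ)} {p q : ℕ} {v : ℕ → ℤ}
    (h : Realizes F p q v) : ∃ v, Realizes F p q v ∧ v (q - 1) ≤ v p := by
  by_cases hv : v (q - 1) ≤ v p
  · exact ⟨v, h, hv⟩
  · exact ⟨-v, h.neg, neg_le_neg (le_of_not_ge hv)⟩

theorem Realizes.mono {F F' : Finset (ℕ × ℕ)} {p q : ℕ} {v : ℕ → ℤ} (h : Realizes F p q v)
    (hF : ∀ c d, p ≤ c → d ≤ q → ((c, d) ∈ F' ↔ (c, d) ∈ F)) : Realizes F' p q v :=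
  ⟨h.inj, fun c d h1 h2 h3 => by rw [h.convex_iff c d h1 h2 h3, hF c d h1 h3]⟩

/-- `v'` is the inflation of `π` by the sequences `v i` on the blocks `[t i, t (i + 1))`; the block
of `x` has the index `k x`. -/
structure IsInflation (a : ℕ) (t : ℕ → ℕ) (π : ℕ → ℤ) (v : ℕ → ℕ → ℤ) (k : ℕ → ℕ)
    (v' : ℕ → ℤ) : Prop where
  index_lt : ∀ x, t 0 ≤ x → x < t a → k x < a
  le : ∀ x, t 0 ≤ x → x < t a → t (k x) ≤ x
  lt : ∀ x, t 0 ≤ x → x < t a → x < t (k x + 1)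
  index_eq : ∀ i x, i < a → t i ≤ x → x < t (i + 1) → k x = i
  mono : ∀ i j, i ≤ j → j ≤ a → t i ≤ t j
  le_iff : ∀ i x y, i < a → t i ≤ x → x < t (i + 1) → t i ≤ y → y < t (i + 1) →
    (v' x ≤ v' y ↔ v i x ≤ v i y)
  lt_of_lt : ∀ x y, t 0 ≤ x → x < t a → t 0 ≤ y → y < t a → π (k x) < π (k y) → v' x < v' y

theorem exists_block_index (a : ℕ) (t : ℕ → ℕ) (x : ℕ) (h0 : t 0 ≤ x) (ha : x < t a) :
    ∃ i < a, t i ≤ x ∧ x < t (i + 1) := by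
  induction a with
  | zero => omega
  | succ a ih =>
    by_cases h : x < t a
    · obtain ⟨i, hi, h⟩ := ih h
      exact ⟨i, by omega, h⟩
    · exact ⟨a, by omega, by omega, ha⟩

theorem exists_isInflation (a : ℕ) (t : ℕ → ℕ) (ht : ∀ i < a, t i < t (i + 1)) (π : ℕ → ℤ)
    (v : ℕ → ℕ → ℤ) : ∃ k v', IsInflation a t π v k v' := by
  have hmono : ∀ i j, i ≤ j → j ≤ a → t i ≤ t j := by
    intro i j hij
    induction j, hij using Nat.le_induction with
    | base => simp
    | succ j hj ih => exact fun h => (ih (by omega)).trans (ht j (by omega)).le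
  have hk : ∀ x, ∃ i, t 0 ≤ x → x < t a → i < a ∧ t i ≤ x ∧ x < t (i + 1) := by
    intro x
    by_cases h : t 0 ≤ x ∧ x < t a
    · obtain ⟨i, hi⟩ := exists_block_index a t x h.1 h.2
      exact ⟨i, fun _ _ => hi⟩
    · exact ⟨0, fun h1 h2 => absurd ⟨h1, h2⟩ h⟩
  choose k hk using hk
  -- With this `M`, in `π (k x) * M + v (k x) x` the first term decides between blocks with
  -- different values of `π`, and the second one decides within a block.
  obtain ⟨M, hM⟩ : ∃ M : ℤ, ∀ x, t 0 ≤ x → x < t a → 2 * |v (k x) x| < M := by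
    refine ⟨∑ x ∈ Finset.range (t a), 2 * |v (k x) x| + 1, fun x _ hx => ?_⟩
    rw [Int.lt_add_one_iff]
    exact Finset.single_le_sum (f := fun x => 2 * |v (k x) x|) (fun y _ => by positivity)
      (Finset.mem_range.2 hx)
  have heq : ∀ i x, i < a → t i ≤ x → x < t (i + 1) → k x = i := by
    intro i x hi h1 h2
    obtain ⟨h3, h4, h5⟩ := hk x ((hmono 0 i (by omega) hi.le).trans h1)
      (h2.trans_le (hmono (i + 1) a hi le_rfl))
    by_contra hne
    rcases Nat.lt_or_gt_of_ne hne with h | h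
    · have := hmono (k x + 1) i h hi.le
      omega
    · have := hmono (i + 1) (k x) h h3.le
      omega
  refine ⟨k, fun x => π (k x) * M + v (k x) x, fun x h1 h2 => (hk x h1 h2).1,
    fun x h1 h2 => (hk x h1 h2).2.1, fun x h1 h2 => (hk x h1 h2).2.2, heq, hmono, ?_, ?_⟩
  · intro i x y hi h1 h2 h3 h4
    simp only [heq i x hi h1 h2, heq i y hi h3 h4, add_le_add_iff_left]
  · intro x y h1 h2 h3 h4 h
    have hx := hM x h1 h2
    have hy := hM y h3 h4
    have hx' := le_abs_self (v (k x) x)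
    have hy' := neg_abs_le (v (k y) y)
    have hpos : 0 ≤ |v (k x) x| := abs_nonneg _
    change π (k x) * M + v (k x) x < π (k y) * M + v (k y) y
    nlinarith [mul_le_mul_of_nonneg_right (Int.add_one_le_iff.2 h) (by omega : 0 ≤ M)]

namespace IsInflation

variable {a : ℕ} {t : ℕ → ℕ} {π : ℕ → ℤ} {v : ℕ → ℕ → ℤ} {k : ℕ → ℕ} {v' : ℕ → ℤ}
  {F : Finset (ℕ × ℕ)}

theorem injOn (h : IsInflation a t π v k v') (hπ : Set.InjOn π (Set.Iio a))
    (hv : ∀ i < a, Realizes F (t i) (t (i + 1)) (v i)) : Set.InjOn v' (Set.Ico (t 0) (t a)) := by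
  rintro x ⟨hx, hx'⟩ y ⟨hy, hy'⟩ hxy
  have hkx := h.index_lt x hx hx'
  have hky := h.index_lt y hy hy'
  have hk : k x = k y := by
    by_contra hne
    rcases lt_or_gt_of_ne (fun h => hne (hπ hkx hky h)) with hlt | hlt
    · exact (h.lt_of_lt x y hx hx' hy hy' hlt).ne hxy
    · exact (h.lt_of_lt y x hy hy' hx hx' hlt).ne' hxy
  have hx1 := h.le x hx hx'
  have hx2 := h.lt x hx hx'
  have hy1 := h.le y hy hy'
  have hy2 := h.lt y hy hy'
  rw [← hk] at hy1 hy2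
  refine (hv _ hkx).inj ⟨hx1, hx2⟩ ⟨hy1, hy2⟩ (le_antisymm ?_ ?_)
  · exact (h.le_iff _ x y hkx hx1 hx2 hy1 hy2).1 hxy.le
  · exact (h.le_iff _ y x hkx hy1 hy2 hx1 hx2).1 hxy.ge

/-- No value from outside block `i` lies between two values taken on it. -/
theorem blockConvex_iff (h : IsInflation a t π v k v') (hπ : Set.InjOn π (Set.Iio a)) {i c d : ℕ}
    (hi : i < a) (hc : t i ≤ c) (hd : d ≤ t (i + 1)) :
    BlockConvex v' (t 0) (t a) c d ↔ BlockConvex (v i) (t i) (t (i + 1)) c d := by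
  have h0 := h.mono 0 i (by omega) hi.le
  have h1 := h.mono (i + 1) a hi le_rfl
  constructor
  · intro hcon x y z hx hx' hy hy' hz hz' hxz hzy
    refine hcon x y z hx hx' hy hy' (by omega) (by omega) ?_ ?_
    · exact (h.le_iff i x z hi (by omega) (by omega) hz hz').2 hxz
    · exact (h.le_iff i z y hi hz hz' (by omega) (by omega)).2 hzy
  · intro hcon x y z hx hx' hy hy' hz hz' hxz hzy
    have hkx := h.index_eq i x hi (by omega) (by omega)
    have hky := h.index_eq i y hi (by omega) (by omega)
    have hkz : k z = i := by
      by_contra hne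
      rcases lt_or_gt_of_ne (fun h' => hne (hπ (h.index_lt z hz hz') hi h')) with hlt | hlt
      · rw [← hkx] at hlt
        exact absurd (h.lt_of_lt z x hz hz' (by omega) (by omega) hlt) (not_lt_of_ge hxz)
      · rw [← hky] at hlt
        exact absurd (h.lt_of_lt y z (by omega) (by omega) hz hz' hlt) (not_lt_of_ge hzy)
    have hz1 := h.le z hz hz'
    have hz2 := h.lt z hz hz'
    rw [hkz] at hz1 hz2
    refine hcon x y z hx hx' hy hy' hz1 hz2 ?_ ?_
    · exact (h.le_iff i x z hi (by omega) (by omega) hz1 hz2).1 hxz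
    · exact (h.le_iff i z y hi hz1 hz2 (by omega) (by omega)).1 hzy

/-- Reduces the realization of a node to `hcross`: an interval that crosses a cut between children
must be the whole block. Only this depends on the choice of `π`. -/
theorem realizes (h : IsInflation a t π v k v') (ha : 2 ≤ a) (ht : ∀ i < a, t i < t (i + 1))
    (hπ : Set.InjOn π (Set.Iio a)) (hv : ∀ i < a, Realizes F (t i) (t (i + 1)) (v i))
    (hF : ∀ c d, (c, d) ∈ F → ∀ i ≤ a, t i ≤ c ∨ d ≤ t i)
    (hcross : ∀ c d i, t 0 ≤ c → d ≤ t a → 0 < i → i < a → c < t i → t i < d →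
      BlockConvex v' (t 0) (t a) c d → c = t 0 ∧ d = t a) :
    Realizes (insert (t 0, t a) F) (t 0) (t a) v' := by
  refine ⟨h.injOn hπ hv, fun c d hc hcd hd => ?_⟩
  have hk := h.index_lt c hc (by omega)
  have hk1 := h.le c hc (by omega)
  have hk2 := h.lt c hc (by omega)
  by_cases hin : d ≤ t (k c + 1)
  · rw [h.blockConvex_iff hπ hk hk1 hin, (hv _ hk).convex_iff c d hk1 hcd hin, Finset.mem_insert]
    refine ⟨Or.inr, fun h' => h'.resolve_left fun h' => ?_⟩
    simp only [Prod.mk.injEq] at h'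
    have h1 := h.mono (k c + 1) a hk le_rfl
    have h2 := ht (a - 1) (by omega)
    have h3 := ht 0 (by omega)
    rw [zero_add] at h3
    rw [show a - 1 + 1 = a by omega] at h2
    rcases Nat.lt_or_ge (k c + 1) a with h4 | h4
    · have := h.mono (k c + 1) (a - 1) (by omega) (by omega)
      omega
    · have := h.mono 1 (k c) (by omega) hk.le
      omega
  · have hka : k c + 1 < a := by
      by_contra hka
      have : k c + 1 = a := by omega
      rw [this] at hin
      exact hin hd
    rw [Finset.mem_insert, Prod.mk.injEq]
    constructor
    · exact fun hcon => Or.inl (hcross c d (k c + 1) hc hd (by omega) hka hk2 (by omega) hcon)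
    · rintro (⟨rfl, rfl⟩ | hcd)
      · exact fun x y z _ _ _ _ h1 h2 _ _ => ⟨h1, h2⟩
      · have := hF c d hcd (k c + 1) (by omega)
        omega

end IsInflation

/-- Two blocks can be put side by side without creating further intervals. -/
theorem exists_realizes_two {F : Finset (ℕ × ℕ)} {t : ℕ → ℕ} (ht : ∀ i < 2, t i < t (i + 1))
    (hv : ∀ i < 2, ∃ v, Realizes F (t i) (t (i + 1)) v)
    (hF : ∀ c d, (c, d) ∈ F → ∀ i ≤ 2, t i ≤ c ∨ d ≤ t i) :
    ∃ v, Realizes (insert (t 0, t 2) F) (t 0) (t 2) v := by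
  have hv' : ∀ i, ∃ v, i < 2 → Realizes F (t i) (t (i + 1)) v ∧ v (t (i + 1) - 1) ≤ v (t i) := by
    intro i
    by_cases hi : i < 2
    · obtain ⟨v, hv⟩ := hv i hi
      obtain ⟨v, hv⟩ := hv.exists_last_le_first
      exact ⟨v, fun _ => hv⟩
    · exact ⟨0, fun h => absurd h hi⟩
  choose v hv using hv'
  obtain ⟨k, v', h⟩ := exists_isInflation 2 t ht (fun i => (i : ℤ)) v
  refine ⟨v', h.realizes le_rfl ht (fun i _ j _ hij => by simpa using hij)
    (fun i hi => (hv i hi).1) hF ?_⟩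
  intro c d i hc hd hi0 hi2 hci hid hcon
  obtain rfl : i = 1 := by omega
  have t0 := ht 0 (by omega)
  have t1 := ht 1 (by omega)
  simp only [zero_add, Nat.reduceAdd] at t0 t1
  have k0 : ∀ x, t 0 ≤ x → x < t 1 → k x = 0 := fun x h1 h2 => h.index_eq 0 x (by omega) h1 h2
  have k1 : ∀ x, t 1 ≤ x → x < t 2 → k x = 1 := fun x h1 h2 => h.index_eq 1 x (by omega) h1 h2
  have hlt : ∀ x y, t 0 ≤ x → x < t 1 → t 1 ≤ y → y < t 2 → v' x < v' y := by
    intro x y h1 h2 h3 h4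
    refine h.lt_of_lt x y h1 (by omega) (by omega) h4 ?_
    rw [k0 x h1 h2, k1 y h3 h4]
    norm_num
  constructor
  -- A crossing interval contains the positions `t 1 - 1` and `t 1`. As the last value of each block
  -- is at most its first, the values at `t 0` and `t 2 - 1` lie between those two.
  · have := hcon (t 1 - 1) (t 1) (t 0) (by omega) (by omega) (by omega) (by omega) (by omega)
      (by omega) ((h.le_iff 0 _ _ (by omega) (by omega) (by simp; omega) (by omega) t0).2
        (hv 0 (by omega)).2) (hlt _ _ le_rfl t0 le_rfl t1).le
    omega
  · have := hcon (t 1 - 1) (t 1) (t 2 - 1) (by omega) (by omega) (by omega) (by omega) (by omega)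
      (by omega) (hlt _ _ (by omega) (by omega) (by omega) (by omega)).le
      ((h.le_iff 1 _ _ (by omega) (by omega) (by simp; omega) (by omega) t1).2
        (hv 1 (by omega)).2)
    omega

/-- The sequence `1, -1, 2, -2, …, 0` of length `a`, which is order isomorphic to a simple
permutation when `4 ≤ a`. -/
def simpleSeq (a i : ℕ) : ℤ :=
  if i + 1 = a then 0 else if i % 2 = 0 then (i / 2 : ℕ) + 1 else -((i / 2 : ℕ) + 1)

theorem simpleSeq_injOn (a : ℕ) : Set.InjOn (simpleSeq a) (Set.Iio a) := by
  intro i hi j hj h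
  simp only [Set.mem_Iio] at hi hj
  unfold simpleSeq at h
  split_ifs at h <;> omega

theorem simpleSeq_one {a : ℕ} (ha : 4 ≤ a) : simpleSeq a 1 = -1 := by
  rw [simpleSeq, if_neg (by omega), if_neg (by omega)]
  norm_num

theorem simpleSeq_two {a : ℕ} (ha : 4 ≤ a) : simpleSeq a 2 = 2 := by
  rw [simpleSeq, if_neg (by omega), if_pos rfl]
  norm_num

/-- Two neighbouring positions before the last have values of opposite signs, so a window with at
least two positions captures the final `0`. With `0` and a positive value it captures the value `1`
at position `0`. If position `a - 2` is negative instead, the window captures `-1` at position `1`,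
hence contains position `2`, which is positive. -/
theorem simpleSeq_simple {a : ℕ} (ha : 4 ≤ a) {i j : ℕ} (hij : i < j) (hj : j < a)
    (h : ∀ x y z, i ≤ x → x ≤ j → i ≤ y → y ≤ j → z < a → simpleSeq a x ≤ simpleSeq a z →
      simpleSeq a z ≤ simpleSeq a y → i ≤ z ∧ z ≤ j) : i = 0 ∧ j + 1 = a := by
  have hlast : simpleSeq a (a - 1) = 0 := by
    unfold simpleSeq
    split_ifs <;> omega
  have h0 : simpleSeq a 0 = 1 := by
    unfold simpleSeq
    split_ifs <;> omega
  have h1 := simpleSeq_one ha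
  have h2 := simpleSeq_two ha
  have heven : ∀ x, x + 1 < a → x % 2 = 0 → simpleSeq a x = (x / 2 : ℕ) + 1 := by
    intro x h1 h2
    unfold simpleSeq
    split_ifs <;> omega
  have hodd : ∀ x, x + 1 < a → x % 2 = 1 → simpleSeq a x = -((x / 2 : ℕ) + 1) := by
    intro x h1 h2
    unfold simpleSeq
    split_ifs <;> omega
  have hja : j + 1 = a := by
    by_contra hne
    rcases Nat.mod_two_eq_zero_or_one i with hi | hi
    · have e1 := heven i (by omega) hi
      have e2 := hodd (i + 1) (by omega) (by omega)
      have := h (i + 1) i (a - 1) (by omega) (by omega) (by omega) (by omega) (by omega)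
        (by omega) (by omega)
      omega
    · have e1 := hodd i (by omega) hi
      have e2 := heven (i + 1) (by omega) (by omega)
      have := h i (i + 1) (a - 1) (by omega) (by omega) (by omega) (by omega) (by omega)
        (by omega) (by omega)
      omega
  refine ⟨?_, hja⟩
  have key : ∀ x, i ≤ x → x + 1 < a → x % 2 = 0 → i = 0 := by
    intro x h3 h4 h5
    have e := heven x h4 h5
    have := h (a - 1) x 0 (by omega) (by omega) (by omega) (by omega) (by omega) (by omega)
      (by omega)
    omega
  by_cases hpar : (a - 2) % 2 = 0
  · exact key (a - 2) (by omega) (by omega) hpar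
  · have e := hodd (a - 2) (by omega) (by omega)
    have := h (a - 2) (a - 1) 1 (by omega) (by omega) (by omega) (by omega) (by omega)
      (by omega) (by omega)
    exact key 2 (by omega) (by omega) rfl

/-- The children met by a crossing interval form an interval of the simple sequence with at least
two terms, so all children are met. It remains to see that the first and last child are contained
entirely. -/
theorem exists_realizes_simple {F : Finset (ℕ × ℕ)} {a : ℕ} (ha : 4 ≤ a) {t : ℕ → ℕ}
    (ht : ∀ i < a, t i < t (i + 1)) (hv : ∀ i < a, ∃ v, Realizes F (t i) (t (i + 1)) v)
    (hF : ∀ c d, (c, d) ∈ F → ∀ i ≤ a, t i ≤ c ∨ d ≤ t i) :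
    ∃ v, Realizes (insert (t 0, t a) F) (t 0) (t a) v := by
  have hv' : ∀ i, ∃ v, i < a → Realizes F (t i) (t (i + 1)) v := by
    intro i
    by_cases hi : i < a
    · obtain ⟨v, hv⟩ := hv i hi
      exact ⟨v, fun _ => hv⟩
    · exact ⟨0, fun h => absurd h hi⟩
  choose v hv using hv'
  obtain ⟨k, v', h⟩ := exists_isInflation a t ht (simpleSeq a) v
  refine ⟨v', h.realizes (by omega) ht (simpleSeq_injOn a) hv hF ?_⟩
  intro c d i hc hd hi0 hia hci hid hcon
  have hkmono : ∀ x y, t 0 ≤ x → x ≤ y → y < t a → k x ≤ k y := by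
    intro x y h1 h2 h3
    by_contra hlt
    have := h.mono (k y + 1) (k x) (by omega) (h.index_lt x h1 (by omega)).le
    have := h.lt y (by omega) h3
    have := h.le x h1 (by omega)
    omega
  -- every block between those of `c` and `d - 1` meets `[c, d)`
  have hmeet : ∀ j, k c ≤ j → j ≤ k (d - 1) → ∃ x, c ≤ x ∧ x < d ∧ k x = j := by
    intro j h1 h2
    have hja := h.index_lt (d - 1) (by omega) (by omega)
    have htj := ht j (by omega)
    rcases h1.eq_or_lt with rfl | h1
    · exact ⟨c, le_rfl, by omega, rfl⟩
    · have e1 := h.mono (k c + 1) j h1 (by omega)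
      have e2 := h.lt c hc (by omega)
      have e3 := h.mono j (k (d - 1)) h2 hja.le
      have e4 := h.le (d - 1) (by omega) (by omega)
      exact ⟨t j, by omega, by omega, h.index_eq j _ (by omega) le_rfl htj⟩
  have hlt : k c < k (d - 1) := by
    have e1 := h.le c hc (by omega)
    have e2 := h.lt (d - 1) (by omega) (by omega)
    by_contra hge
    have hle := hkmono c (d - 1) hc (by omega) (by omega)
    have hk := h.index_lt c hc (by omega)
    rw [show k (d - 1) = k c by omega] at e2
    rcases Nat.lt_or_ge (k c) i with h1 | h1
    · have := h.mono (k c + 1) i h1 hia.le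
      omega
    · have := h.mono i (k c) h1 hk.le
      omega
  have hja := h.index_lt (d - 1) (by omega) (by omega)
  have hsimple := simpleSeq_simple ha hlt hja (fun x y z hx hx' hy hy' hz hxz hzy => by
    by_cases hzx : z = x
    · omega
    by_cases hzy' : z = y
    · omega
    have hxz' : simpleSeq a x < simpleSeq a z := hxz.lt_of_ne fun e =>
      hzx (simpleSeq_injOn a (Set.mem_Iio.2 (by omega)) (Set.mem_Iio.2 hz) e).symm
    have hzy' : simpleSeq a z < simpleSeq a y := hzy.lt_of_ne fun e =>
      hzy' (simpleSeq_injOn a (Set.mem_Iio.2 hz) (Set.mem_Iio.2 (by omega)) e)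
    obtain ⟨x', hx1, hx2, rfl⟩ := hmeet x hx hx'
    obtain ⟨y', hy1, hy2, rfl⟩ := hmeet y hy hy'
    have htz := ht z hz
    have e0 := h.mono 0 z (by omega) hz.le
    have e1 := h.mono (z + 1) a hz le_rfl
    have hkz := h.index_eq z (t z) hz le_rfl htz
    rw [← hkz] at hxz' hzy'
    have := hcon x' y' (t z) hx1 hx2 hy1 hy2 e0 (by omega)
      (h.lt_of_lt _ _ (by omega) (by omega) e0 (by omega) hxz').le
      (h.lt_of_lt _ _ e0 (by omega) (by omega) (by omega) hzy').le
    rw [← hkz]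
    exact ⟨hkmono c _ hc this.1 (by omega), hkmono _ (d - 1) e0 (by omega) (by omega)⟩)
  -- The outer children have the values `1` and `0`, strictly between the values `-1` and `2` of
  -- children `1` and `2`, both of which the interval meets.
  have hends : ∀ z, t 0 ≤ z → z < t a → (k z = 0 ∨ k z + 1 = a) → c ≤ z ∧ z < d := by
    intro z hz hz' hkz
    have v1 := simpleSeq_one ha
    have v2 := simpleSeq_two ha
    have v3 : -1 < simpleSeq a (k z) ∧ simpleSeq a (k z) < 2 := by
      unfold simpleSeq
      split_ifs <;> omega
    obtain ⟨x, hx1, hx2, hx⟩ := hmeet 1 (by omega) (by omega)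
    obtain ⟨y, hy1, hy2, hy⟩ := hmeet 2 (by omega) (by omega)
    refine hcon x y z hx1 hx2 hy1 hy2 hz hz' ?_ ?_
    · exact (h.lt_of_lt _ _ (by omega) (by omega) hz hz' (by rw [hx, v1]; exact v3.1)).le
    · exact (h.lt_of_lt _ _ hz hz' (by omega) (by omega) (by rw [hy, v2]; exact v3.2)).le
  have ht0 := ht 0 (by omega)
  have hta := ht (a - 1) (by omega)
  have hm1 := h.mono 1 a (by omega) le_rfl
  have hm2 := h.mono 0 (a - 1) (by omega) (by omega)
  rw [show a - 1 + 1 = a by omega] at hta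
  simp only [zero_add] at ht0
  have e1 := hends (t 0) le_rfl (by omega)
    (Or.inl (h.index_eq 0 (t 0) (by omega) le_rfl (by simpa using ht0)))
  have e2 := hends (t a - 1) (by omega) (by omega) (Or.inr (by
    rw [h.index_eq (a - 1) (t a - 1) (by omega) (by omega)
      (by rw [show a - 1 + 1 = a by omega]; omega)]
    omega))
  omega

/-- Every tree of a plane forest is the tree of intervals of a sequence of distinct integers. -/
theorem PlaneForest.isChain_realizes {s : List ℕ} {F : Finset (ℕ × ℕ)} {n : ℕ}
    (h : PlaneForest s F n) : (n :: s).IsChain (fun q p => ∃ v, Realizes F p q v) := by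
  induction h with
  | nil => simp
  | @leaf s F n h ih =>
    refine List.isChain_cons_cons.2 ⟨⟨fun _ => 0, ?_, ?_⟩, ?_⟩
    · intro x hx y hy _
      simp only [Set.mem_Ico] at hx hy
      omega
    · intro c d h1 h2 h3
      obtain rfl : c = n := by omega
      obtain rfl : d = c + 1 := by omega
      simp only [Finset.mem_insert_self, iff_true]
      exact fun x y z _ _ _ _ h1 h2 _ _ => ⟨h1, h2⟩
    · refine ih.imp_of_mem_imp fun q p hq hp ⟨v, hv⟩ => ⟨v, hv.mono fun c d hc hd => ?_⟩
      have : q ≤ n := by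
        rcases List.mem_cons.1 hq with rfl | hq
        · exact le_rfl
        · exact (h.lt_of_mem_starts hq).le
      rw [Finset.mem_insert, Prod.mk.injEq]
      exact or_iff_right (by omega)
  | @node l b s F n h ha ih =>
    refine List.isChain_cons_cons.2 ⟨?_, ?_⟩
    · set L := n :: (l ++ b :: s) with hL
      have hlen : l.length + 1 < L.length := by simp [hL]
      have hch := List.isChain_iff_getElem.1 ih
      have hlt := List.isChain_iff_getElem.1 h.bounds.1
      -- `L` lists the cuts from right to left; `t` reads the cuts of the joined trees from left to
      -- right, from `b` to `n`.
      let t : ℕ → ℕ := fun i => L.getD (l.length + 1 - i) 0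
      have hb : t 0 = b := by simp [t, hL]
      have hn : t (l.length + 1) = n := by simp [t, hL]
      have htt : ∀ i < l.length + 1, t i < t (i + 1) ∧ ∃ v, Realizes F (t i) (t (i + 1)) v := by
        intro i hi
        have e : l.length + 1 - i = l.length + 1 - (i + 1) + 1 := by omega
        have hj : l.length + 1 - (i + 1) + 1 < L.length := by omega
        have h1 := hch (l.length + 1 - (i + 1)) hj
        have h2 := hlt (l.length + 1 - (i + 1)) hj
        simp only [t]
        rw [List.getD_eq_getElem _ _ (by omega), List.getD_eq_getElem _ _ (by omega)]
        simp only [e]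
        exact ⟨h2, h1⟩
      have hF : ∀ c d, (c, d) ∈ F → ∀ i ≤ l.length + 1, t i ≤ c ∨ d ≤ t i := by
        intro c d hcd i hi
        have hmem : t i ∈ L := by
          simp only [t]
          rw [List.getD_eq_getElem _ _ (by omega)]
          exact List.getElem_mem _
        rcases List.mem_cons.1 hmem with h' | h'
        · exact Or.inr (h' ▸ (h.bounds.2 c d hcd).2)
        · exact h.le_or_le_of_mem _ h' c d hcd
      rcases ha with ha | ha
      · rw [ha] at htt hF hn
        rw [← hb, ← hn]
        exact exists_realizes_two (fun i hi => (htt i hi).1) (fun i hi => (htt i hi).2) hF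
      · rw [← hb, ← hn]
        exact exists_realizes_simple ha (fun i hi => (htt i hi).1) (fun i hi => (htt i hi).2) hF
    · have ih' := (List.isChain_append.1 ih.tail).2.1
      refine ih'.imp_of_mem_imp fun q p hq hp ⟨v, hv⟩ => ⟨v, hv.mono fun c d hc hd => ?_⟩
      have hqn := h.lt_of_mem_starts (List.mem_append_right l hq)
      rw [Finset.mem_insert, Prod.mk.injEq]
      exact or_iff_right (by omega)

/-! ### Finite posets whose Hasse diagram is a tree. -/

section Hasse

variable {α : Type*} [PartialOrder α]

theorem hasse_connected [Finite α] [OrderTop α] : (SimpleGraph.hasse α).Connected := by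
  have key : ∀ x : α, (SimpleGraph.hasse α).Reachable x ⊤ := by
    intro x
    induction x using WellFoundedGT.induction with
    | ind x ih =>
      by_cases hx : x = ⊤
      · rw [hx]
      · obtain ⟨y, hy⟩ := exists_covBy_of_wellFoundedLT (a := x) (by simpa using hx)
        exact (SimpleGraph.Adj.reachable (Or.inl hy)).trans (ih y hy.lt)
  exact { preconnected := fun x y => (key x).trans (key y).symm, nonempty := ⟨⊤⟩ }

theorem ncard_edgeSet_hasse :
    Nat.card (SimpleGraph.hasse α).edgeSet = Nat.card {p : α × α // p.1 ⋖ p.2} := by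
  symm
  refine Nat.card_congr (Equiv.ofBijective
    (fun p => ⟨s(p.1.1, p.1.2), Or.inl p.2⟩) ⟨?_, ?_⟩)
  · rintro ⟨⟨x, y⟩, h⟩ ⟨⟨x', y'⟩, h'⟩ heq
    rcases Sym2.eq_iff.1 (congrArg Subtype.val heq) with ⟨rfl, rfl⟩ | ⟨rfl, rfl⟩
    · rfl
    · exact absurd h.lt (not_lt_of_gt h'.lt)
  · rintro ⟨e, he⟩
    induction e using Sym2.ind with
    | _ x y =>
      rcases he with h | h
      · exact ⟨⟨(x, y), h⟩, rfl⟩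
      · exact ⟨⟨(y, x), h⟩, by simp [Sym2.eq_swap]⟩

/-- In a finite poset with a greatest element, the Hasse diagram is a tree when every element but
the greatest one is covered by exactly one element. -/
theorem isTree_hasse_iff_unique_cover [Finite α] [OrderTop α] :
    (SimpleGraph.hasse α).IsTree ↔ ∀ x y z : α, x ⋖ y → x ⋖ z → y = z := by
  have hcov : ∀ x : {x : α // x ≠ ⊤}, ∃ y, x.1 ⋖ y := fun x =>
    exists_covBy_of_wellFoundedLT (by simpa using x.2)
  choose f hf using hcov
  -- One chosen cover per element other than `⊤` gives one edge fewer than there are vertices. The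
  -- graph is connected, so it is a tree exactly when these are all the edges.
  let g : {x : α // x ≠ ⊤} → {p : α × α // p.1 ⋖ p.2} := fun x => ⟨(x.1, f x), hf x⟩
  have hg : Function.Injective g := by
    intro x y h
    have := congrArg (fun p => p.1.1) h
    exact Subtype.ext this
  have hcard : Nat.card {x : α // x ≠ ⊤} + 1 = Nat.card α := by
    have := Fintype.ofFinite α
    classical
    rw [Nat.card_eq_fintype_card, Nat.card_eq_fintype_card, Fintype.card_subtype_compl]
    have : 0 < Fintype.card α := Fintype.card_pos_iff.2 ⟨⊤⟩
    simp
    omega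
  rw [SimpleGraph.isTree_iff_connected_and_card, ncard_edgeSet_hasse, ← hcard,
    Nat.add_right_cancel_iff]
  constructor
  · rintro ⟨-, h⟩ x y z hy hz
    have hs : Function.Surjective g := (hg.bijective_of_nat_card_le h.le).2
    obtain ⟨a, ha⟩ := hs ⟨(x, y), hy⟩
    obtain ⟨b, hb⟩ := hs ⟨(x, z), hz⟩
    simp only [g, Subtype.mk.injEq, Prod.mk.injEq] at ha hb
    obtain rfl : a = b := Subtype.ext (ha.1.trans hb.1.symm)
    rw [← ha.2, hb.2]
  · intro h
    refine ⟨hasse_connected, (Nat.card_congr (Equiv.ofBijective g ⟨hg, ?_⟩)).symm⟩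
    rintro ⟨⟨x, y⟩, hxy⟩
    have hx : x ≠ ⊤ := hxy.lt.ne_top
    refine ⟨⟨x, hx⟩, ?_⟩
    simp only [g, Subtype.mk.injEq, Prod.mk.injEq, true_and]
    exact h x _ _ (hf ⟨x, hx⟩) hxy

/-- Where covers are unique, two elements strictly above `x` both lie above its only cover, so
descending induction makes the elements above `x` a chain. -/
theorem isTree_hasse_iff [Finite α] [OrderTop α] :
    (SimpleGraph.hasse α).IsTree ↔ ∀ x y z : α, x ≤ y → x ≤ z → y ≤ z ∨ z ≤ y := by
  rw [isTree_hasse_iff_unique_cover]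
  constructor
  · intro h x
    induction x using WellFoundedGT.induction with
    | ind x ih =>
      intro y z hy hz
      rcases hy.eq_or_lt with rfl | hy
      · exact Or.inl hz
      rcases hz.eq_or_lt with rfl | hz
      · exact Or.inr hy.le
      obtain ⟨y', hy1, hy2⟩ := exists_covBy_le_of_lt hy
      obtain ⟨z', hz1, hz2⟩ := exists_covBy_le_of_lt hz
      obtain rfl := h x _ _ hy1 hz1
      exact ih y' hy1.lt y z hy2 hz2
  · intro h x y z hy hz
    rcases h x y z hy.le hz.le with hyz | hyz
    · exact hyz.eq_of_not_lt fun hlt => hz.2 hy.lt hlt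
    · exact (hyz.eq_of_not_lt fun hlt => hy.2 hz.lt hlt).symm

end Hasse

/-! ### Families of interval blocks of a sequence. -/

open Classical in
/-- The blocks of positions in `[0, n)` on which the values of `v` form an interval. -/
noncomputable def blockFamily (n : ℕ) (v : ℕ → ℤ) : Finset (ℕ × ℕ) :=
  (Finset.range (n + 1) ×ˢ Finset.range (n + 1)).filter
    fun p => p.1 < p.2 ∧ BlockConvex v 0 n p.1 p.2

theorem mem_blockFamily {n : ℕ} {v : ℕ → ℤ} {c d : ℕ} :
    (c, d) ∈ blockFamily n v ↔ c < d ∧ d ≤ n ∧ BlockConvex v 0 n c d := by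
  simp only [blockFamily, Finset.mem_filter, Finset.mem_product, Finset.mem_range]
  constructor
  · rintro ⟨⟨h1, h2⟩, h3, h4⟩
    exact ⟨h3, by omega, h4⟩
  · rintro ⟨h1, h2, h3⟩
    exact ⟨⟨by omega, by omega⟩, h1, h3⟩

theorem blockFamily_congr {n : ℕ} {v v' : ℕ → ℤ}
    (h : ∀ x < n, ∀ y < n, (v x ≤ v y ↔ v' x ≤ v' y)) : blockFamily n v = blockFamily n v' := by
  ext ⟨c, d⟩
  rw [mem_blockFamily, mem_blockFamily]
  refine and_congr_right fun _ => and_congr_right fun hd => ?_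
  constructor
  · intro hc x y z h1 h2 h3 h4 h5 h6 h7 h8
    exact hc x y z h1 h2 h3 h4 h5 h6 ((h _ (by omega) _ h6).2 h7) ((h _ h6 _ (by omega)).2 h8)
  · intro hc x y z h1 h2 h3 h4 h5 h6 h7 h8
    exact hc x y z h1 h2 h3 h4 h5 h6 ((h _ (by omega) _ h6).1 h7) ((h _ h6 _ (by omega)).1 h8)

theorem Realizes.eq_blockFamily {F : Finset (ℕ × ℕ)} {n : ℕ} {v : ℕ → ℤ} (h : Realizes F 0 n v)
    (hF : ∀ c d, (c, d) ∈ F → c < d ∧ d ≤ n) : F = blockFamily n v := by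
  ext ⟨c, d⟩
  rw [mem_blockFamily]
  constructor
  · intro hcd
    obtain ⟨h1, h2⟩ := hF c d hcd
    exact ⟨h1, h2, (h.convex_iff c d (by omega) h1 h2).2 hcd⟩
  · rintro ⟨h1, h2, h3⟩
    exact (h.convex_iff c d (by omega) h1 h2).1 h3

theorem singleton_mem_blockFamily {n : ℕ} {v : ℕ → ℤ} (hv : Set.InjOn v (Set.Ico 0 n)) {c : ℕ}
    (hc : c < n) : (c, c + 1) ∈ blockFamily n v := by
  refine mem_blockFamily.2 ⟨by omega, hc, fun x y z h1 h2 h3 h4 h5 h6 h7 h8 => ?_⟩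
  obtain rfl : x = c := by omega
  obtain rfl : y = x := by omega
  have := hv ⟨by omega, h6⟩ ⟨by omega, hc⟩ (le_antisymm h8 h7)
  omega

theorem univ_mem_blockFamily {n : ℕ} {v : ℕ → ℤ} (hn : 0 < n) : (0, n) ∈ blockFamily n v :=
  mem_blockFamily.2 ⟨hn, le_rfl, fun _ _ _ _ _ _ _ h1 h2 _ _ => ⟨h1, h2⟩⟩

/-- An intruder between values of `[c, f)` lies in `[c, d)`, hence in `[f, d)`, and can only
separate a value of the first block from one of the second. -/
theorem BlockConvex.union {v : ℕ → ℤ} {n c e f d : ℕ} (hce : BlockConvex v 0 n c e)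
    (hef : BlockConvex v 0 n e f) (hcd : BlockConvex v 0 n c d) (h2 : e < f) (h3 : f < d)
    (hno : ∀ x y z, c ≤ x → x < e → e ≤ y → y < f → f ≤ z → z < d →
      ¬ ((v x ≤ v z ∧ v z ≤ v y) ∨ (v y ≤ v z ∧ v z ≤ v x))) : BlockConvex v 0 n c f := by
  intro x y z hx hx' hy hy' hz hz' hxz hzy
  obtain ⟨h4, h5⟩ := hcd x y z hx (by omega) hy (by omega) hz hz' hxz hzy
  by_contra hcon
  have hfz : f ≤ z := by omega
  rcases Nat.lt_or_ge x e with hxe | hxe <;> rcases Nat.lt_or_ge y e with hye | hye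
  · have := hce x y z hx hxe hy hye hz hz' hxz hzy
    omega
  · exact hno x y z hx hxe hye hy' hfz h5 (Or.inl ⟨hxz, hzy⟩)
  · exact hno y x z hy hye hxe hx' hfz h5 (Or.inr ⟨hxz, hzy⟩)
  · have := hef x y z hxe hx' hye hy' hz hz' hxz hzy
    omega

theorem BlockConvex.union' {v : ℕ → ℤ} {n c e f d : ℕ} (hef : BlockConvex v 0 n e f)
    (hfd : BlockConvex v 0 n f d) (hcd : BlockConvex v 0 n c d) (h1 : c < e) (h2 : e < f)
    (hno : ∀ x y z, f ≤ x → x < d → e ≤ y → y < f → c ≤ z → z < e →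
      ¬ ((v x ≤ v z ∧ v z ≤ v y) ∨ (v y ≤ v z ∧ v z ≤ v x))) : BlockConvex v 0 n e d := by
  intro x y z hx hx' hy hy' hz hz' hxz hzy
  obtain ⟨h4, h5⟩ := hcd x y z (by omega) hx' (by omega) hy' hz hz' hxz hzy
  by_contra hcon
  have hze : z < e := by omega
  rcases Nat.lt_or_ge x f with hxe | hxe <;> rcases Nat.lt_or_ge y f with hye | hye
  · have := hef x y z hx hxe hy hye hz hz' hxz hzy
    omega
  · exact hno y x z hye hy' hx hxe h4 hze (Or.inr ⟨hxz, hzy⟩)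
  · exact hno x y z hxe hx' hy hye h4 hze (Or.inl ⟨hxz, hzy⟩)
  · have := hfd x y z hxe hx' hye hy' hz hz' hxz hzy
    omega

/-- The values of two disjoint intervals do not interleave, so a single comparison decides all of
them. -/
theorem BlockConvex.lt_of_lt {v : ℕ → ℤ} {n c e c' e' : ℕ} (h : BlockConvex v 0 n c e)
    (h' : BlockConvex v 0 n c' e') (he : e ≤ n) (he' : e' ≤ n) (hdis : e ≤ c' ∨ e' ≤ c)
    {x y a b : ℕ} (hx : c ≤ x) (hx' : x < e) (hy : c' ≤ y) (hy' : y < e') (ha : c ≤ a)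
    (ha' : a < e) (hb : c' ≤ b) (hb' : b < e') (hxy : v x < v y) : v a < v b := by
  by_contra! hba
  rcases le_or_gt (v b) (v x) with h1 | h1
  · have := h' b y x hb hb' hy hy' (by omega) (by omega) h1 hxy.le
    omega
  · have := h x a b hx hx' ha ha' (by omega) (by omega) h1.le hba
    omega

/-- The permutations of three elements are not simple. -/
theorem blockFamily_three {n : ℕ} {v : ℕ → ℤ} (hv : Set.InjOn v (Set.Ico 0 n)) {c e f d : ℕ}
    (hd : d ≤ n) (h1 : c < e) (h2 : e < f) (h3 : f < d) (hce : (c, e) ∈ blockFamily n v)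
    (hef : (e, f) ∈ blockFamily n v) (hfd : (f, d) ∈ blockFamily n v)
    (hcd : (c, d) ∈ blockFamily n v) : (c, f) ∈ blockFamily n v ∨ (e, d) ∈ blockFamily n v := by
  simp only [mem_blockFamily] at *
  have ne : ∀ x y, x < n → y < n → x ≠ y → v x ≠ v y := fun x y hx hy hxy h =>
    hxy (hv ⟨by omega, hx⟩ ⟨by omega, hy⟩ h)
  -- Either the third block lies between the first two in value, so that the first is extreme and
  -- the other two merge, or it does not, and the first two merge.
  by_cases hA : ∃ x y z, (c ≤ x ∧ x < e) ∧ (e ≤ y ∧ y < f) ∧ (f ≤ z ∧ z < d) ∧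
      ((v x ≤ v z ∧ v z ≤ v y) ∨ (v y ≤ v z ∧ v z ≤ v x))
  · right
    refine ⟨by omega, hd, hef.2.2.union' hfd.2.2 hcd.2.2 h1 h2 ?_⟩
    intro z' y' x' hz1 hz2 hy1 hy2 hx1 hx2 hcon
    obtain ⟨x, y, z, ⟨a1, a2⟩, ⟨a3, a4⟩, ⟨a5, a6⟩, h⟩ := hA
    have n1 := ne x z (by omega) (by omega) (by omega)
    have n3 := ne z' x' (by omega) (by omega) (by omega)
    rcases h with h | h
    · have := hce.2.2.lt_of_lt hfd.2.2 (by omega) (by omega) (by omega) a1 a2 a5 a6 hx1 hx2 hz1 hz2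
        (by omega)
      have := hce.2.2.lt_of_lt hef.2.2 (by omega) (by omega) (by omega) a1 a2 a3 a4 hx1 hx2 hy1 hy2
        (by omega)
      omega
    · have := hfd.2.2.lt_of_lt hce.2.2 (by omega) (by omega) (by omega) a5 a6 a1 a2 hz1 hz2 hx1 hx2
        (by omega)
      have := hef.2.2.lt_of_lt hce.2.2 (by omega) (by omega) (by omega) a3 a4 a1 a2 hy1 hy2 hx1 hx2
        (by omega)
      omega
  · left
    refine ⟨by omega, by omega, hce.2.2.union hef.2.2 hcd.2.2 h2 h3 ?_⟩
    exact fun x y z b1 b2 b3 b4 b5 b6 hcon => hA ⟨x, y, z, ⟨b1, b2⟩, ⟨b3, b4⟩, ⟨b5, b6⟩, hcon⟩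

/-! ### Interval posets of permutations in terms of blocks. -/

/-- The word of a permutation, as a sequence of integers. -/
def permSeq {n : ℕ} (σ : Equiv.Perm (Fin n)) (x : ℕ) : ℤ :=
  if h : x < n then ((σ ⟨x, h⟩ : ℕ) : ℤ) else 0

theorem permSeq_apply {n : ℕ} (σ : Equiv.Perm (Fin n)) (i : Fin n) :
    permSeq σ i = ((σ i : ℕ) : ℤ) := by
  simp [permSeq]

theorem permSeq_le_iff {n : ℕ} (σ : Equiv.Perm (Fin n)) (i j : Fin n) :
    permSeq σ i ≤ permSeq σ j ↔ σ i ≤ σ j := by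
  rw [permSeq_apply, permSeq_apply, Nat.cast_le, Fin.val_fin_le]

theorem permSeq_injOn {n : ℕ} (σ : Equiv.Perm (Fin n)) : Set.InjOn (permSeq σ) (Set.Ico 0 n) := by
  rintro x ⟨-, hx⟩ y ⟨-, hy⟩ h
  have h1 := permSeq_apply σ ⟨x, hx⟩
  have h2 := permSeq_apply σ ⟨y, hy⟩
  simp only at h1 h2
  rw [h1, h2, Nat.cast_inj, Fin.val_inj, σ.injective.eq_iff] at h
  exact congrArg Fin.val h

/-- Standardization: the inverse of the sorting permutation sends each position to the rank of its
value, and intervals depend only on relative order. -/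
theorem exists_perm {n : ℕ} {v : ℕ → ℤ} (hv : Set.InjOn v (Set.Ico 0 n)) :
    ∃ σ : Equiv.Perm (Fin n), blockFamily n (permSeq σ) = blockFamily n v := by
  let f : Fin n → ℤ := fun i => v i
  have hf : Function.Injective f := fun i j h => Fin.ext (hv ⟨by simp, i.2⟩ ⟨by simp, j.2⟩ h)
  have hmono : StrictMono (f ∘ Tuple.sort f) :=
    (Tuple.monotone_sort f).strictMono_of_injective (hf.comp (Equiv.injective _))
  refine ⟨(Tuple.sort f).symm, blockFamily_congr fun x hx y hy => ?_⟩
  rw [permSeq_le_iff _ ⟨x, hx⟩ ⟨y, hy⟩, ← hmono.le_iff_le]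
  simp [f]

/-- The values of `σ` at the positions in `[c, d)`. -/
def blockSet {n : ℕ} (σ : Equiv.Perm (Fin n)) (c d : ℕ) : Finset (Fin n) :=
  Finset.univ.filter fun y => c ≤ (σ.symm y : ℕ) ∧ (σ.symm y : ℕ) < d

theorem apply_mem_blockSet {n : ℕ} {σ : Equiv.Perm (Fin n)} {c d : ℕ} {i : Fin n} :
    σ i ∈ blockSet σ c d ↔ c ≤ (i : ℕ) ∧ (i : ℕ) < d := by
  simp [blockSet]

theorem ext_apply {n : ℕ} {σ : Equiv.Perm (Fin n)} {I J : Finset (Fin n)}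
    (h : ∀ i, σ i ∈ I ↔ σ i ∈ J) : I = J := by
  ext y
  simpa using h (σ.symm y)

theorem map_Icc_eq_blockSet {n : ℕ} (σ : Equiv.Perm (Fin n)) (c d : Fin n) :
    (Finset.Icc c d).map σ.toEmbedding = blockSet σ c (d + 1) := by
  refine ext_apply (σ := σ) fun i => ?_
  rw [apply_mem_blockSet, Finset.mem_map_equiv, Equiv.symm_apply_apply, Finset.mem_Icc,
    Fin.le_def, Fin.le_def]
  omega

theorem blockSet_mono_iff {n : ℕ} {σ : Equiv.Perm (Fin n)} {c d c' d' : ℕ} (hcd : c < d)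
    (hd : d ≤ n) : blockSet σ c d ⊆ blockSet σ c' d' ↔ c' ≤ c ∧ d ≤ d' := by
  constructor
  · intro h
    have h1 := apply_mem_blockSet.1 (h (apply_mem_blockSet (i := ⟨c, by omega⟩).2 ⟨le_rfl, hcd⟩))
    have h2 := apply_mem_blockSet.1 (h (apply_mem_blockSet (i := ⟨d - 1, by omega⟩).2
      ⟨by simp only; omega, by simp only; omega⟩))
    simp only at h1 h2
    omega
  · intro h y hy
    obtain ⟨i, rfl⟩ := σ.surjective y
    rw [apply_mem_blockSet] at hy ⊢
    omega

theorem nonempty_isInterval_iff {n : ℕ} (σ : Equiv.Perm (Fin n)) (I : Finset (Fin n)) :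
    I.Nonempty ∧ IsInterval σ I ↔
      ∃ c d, (c, d) ∈ blockFamily n (permSeq σ) ∧ I = blockSet σ c d := by
  constructor
  · rintro ⟨hne, ⟨a, b, hab⟩, c, d, hcd⟩
    have hle : c ≤ d := by
      rw [hcd, Finset.map_nonempty, Finset.nonempty_Icc] at hne
      exact hne
    have hI := hcd.trans (map_Icc_eq_blockSet σ c d)
    refine ⟨c, d + 1, mem_blockFamily.2 ⟨?_, d.2, ?_⟩, hI⟩
    · have := Fin.le_def.1 hle
      omega
    · intro x y z hx hx' hy hy' hz hz' hxz hzy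
      have hd := d.2
      rw [permSeq_le_iff σ ⟨x, by omega⟩ ⟨z, hz'⟩] at hxz
      rw [permSeq_le_iff σ ⟨z, hz'⟩ ⟨y, by omega⟩] at hzy
      have h1 : σ ⟨x, by omega⟩ ∈ I := hI ▸ apply_mem_blockSet.2 ⟨hx, hx'⟩
      have h2 : σ ⟨y, by omega⟩ ∈ I := hI ▸ apply_mem_blockSet.2 ⟨hy, hy'⟩
      have h3 : σ ⟨z, hz'⟩ ∈ I := by
        rw [hab, Finset.mem_Icc] at h1 h2 ⊢
        exact ⟨h1.1.trans hxz, hzy.trans h2.2⟩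
      rw [hI, apply_mem_blockSet] at h3
      exact h3
  · rintro ⟨c, d, hcd, rfl⟩
    obtain ⟨h1, h2, h3⟩ := mem_blockFamily.1 hcd
    have hne : (blockSet σ c d).Nonempty :=
      ⟨σ ⟨c, by omega⟩, apply_mem_blockSet.2 ⟨le_rfl, h1⟩⟩
    refine ⟨hne, ⟨(blockSet σ c d).min' hne, (blockSet σ c d).max' hne, ?_⟩, ?_⟩
    · ext y
      rw [Finset.mem_Icc]
      refine ⟨fun hy => ⟨Finset.min'_le _ _ hy, Finset.le_max' _ _ hy⟩, fun ⟨hy1, hy2⟩ => ?_⟩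
      obtain ⟨z, rfl⟩ := σ.surjective y
      obtain ⟨a, ha⟩ := σ.surjective ((blockSet σ c d).min' hne)
      obtain ⟨b, hb⟩ := σ.surjective ((blockSet σ c d).max' hne)
      have ha' := apply_mem_blockSet.1 (ha ▸ Finset.min'_mem _ hne)
      have hb' := apply_mem_blockSet.1 (hb ▸ Finset.max'_mem _ hne)
      rw [← ha] at hy1
      rw [← hb] at hy2
      exact apply_mem_blockSet.2 (h3 a b z ha'.1 ha'.2 hb'.1 hb'.2 (by omega) z.2
        ((permSeq_le_iff σ a z).2 hy1) ((permSeq_le_iff σ z b).2 hy2))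
    · refine ⟨⟨c, by omega⟩, ⟨d - 1, by omega⟩, ?_⟩
      rw [map_Icc_eq_blockSet]
      simp only
      rw [Nat.sub_add_cancel (by omega)]

/-- The block `[c, d)` of positions, as an element of the interval poset. -/
def blockInterval {n : ℕ} {σ : Equiv.Perm (Fin n)} {c d : ℕ}
    (h : (c, d) ∈ blockFamily n (permSeq σ)) : NonemptyInterval σ :=
  ⟨blockSet σ c d, (nonempty_isInterval_iff σ _).2 ⟨c, d, h, rfl⟩⟩

theorem singletonInterval_le_iff {n : ℕ} {σ : Equiv.Perm (Fin n)} {j : Fin n}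
    {I : NonemptyInterval σ} : singletonInterval σ j ≤ I ↔ j ∈ I.1 :=
  Finset.singleton_subset_iff

/-- An interval poset is a tree when no two intervals overlap. -/
theorem isTree_iff_laminar {n : ℕ} (hn : 1 ≤ n) (σ : Equiv.Perm (Fin n)) :
    (modifiedIntervalPoset σ).IsTree ↔ ∀ c d c' d', (c, d) ∈ blockFamily n (permSeq σ) →
      (c', d') ∈ blockFamily n (permSeq σ) → c < c' → c' < d → d' ≤ d := by
  let _ : OrderTop (NonemptyInterval σ) :=
    { top := blockInterval (univ_mem_blockFamily hn)
      le_top := fun I y _ => by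
        obtain ⟨i, rfl⟩ := σ.surjective y
        exact apply_mem_blockSet.2 ⟨Nat.zero_le _, i.2⟩ }
  change (SimpleGraph.hasse (NonemptyInterval σ)).IsTree ↔ _
  rw [isTree_hasse_iff]
  constructor
  · intro h c d c' d' hcd hcd' h1 h2
    obtain ⟨h3, h4, -⟩ := mem_blockFamily.1 hcd
    obtain ⟨h5, h6, -⟩ := mem_blockFamily.1 hcd'
    rcases h (singletonInterval σ (σ ⟨c', by omega⟩)) (blockInterval hcd) (blockInterval hcd')
      (singletonInterval_le_iff.2 (apply_mem_blockSet.2 ⟨h1.le, h2⟩))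
      (singletonInterval_le_iff.2 (apply_mem_blockSet.2 ⟨le_rfl, h5⟩)) with h | h
    · have := (blockSet_mono_iff h3 h4).1 h
      omega
    · exact ((blockSet_mono_iff h5 h6).1 h).2
  · rintro h ⟨K, hK⟩ ⟨I, hI⟩ ⟨J, hJ⟩ (hKI : K ⊆ I) (hKJ : K ⊆ J)
    change I ⊆ J ∨ J ⊆ I
    obtain ⟨y, hy⟩ := hK.1
    obtain ⟨i, rfl⟩ := σ.surjective y
    obtain ⟨c, d, hcd, rfl⟩ := (nonempty_isInterval_iff σ I).1 hI
    obtain ⟨c', d', hcd', rfl⟩ := (nonempty_isInterval_iff σ J).1 hJ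
    obtain ⟨h3, h4, -⟩ := mem_blockFamily.1 hcd
    obtain ⟨h5, h6, -⟩ := mem_blockFamily.1 hcd'
    rw [blockSet_mono_iff h3 h4, blockSet_mono_iff h5 h6]
    have hi := apply_mem_blockSet.1 (hKI hy)
    have hi' := apply_mem_blockSet.1 (hKJ hy)
    rcases Nat.lt_trichotomy c c' with hlt | hlt | hlt
    · have := h c d c' d' hcd hcd' hlt (by omega)
      omega
    · omega
    · have := h c' d' c d hcd' hcd hlt (by omega)
      omega

/-- The block of an interval is the set of indices of the minimal elements below it, which the
isomorphism preserves. -/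
theorem blockFamily_subset_of_same {n : ℕ} {σ τ : Equiv.Perm (Fin n)}
    (h : (modifiedIntervalPoset σ).Same (modifiedIntervalPoset τ)) :
    blockFamily n (permSeq σ) ⊆ blockFamily n (permSeq τ) := by
  obtain ⟨e, he⟩ := h
  rintro ⟨c, d⟩ hcd
  obtain ⟨h1, h2, -⟩ := mem_blockFamily.1 hcd
  let J : NonemptyInterval τ := e (blockInterval hcd)
  have hJ : ∀ i, τ i ∈ J.1 ↔ c ≤ (i : ℕ) ∧ (i : ℕ) < d := by
    intro i
    rw [← singletonInterval_le_iff, ← apply_mem_blockSet (σ := σ)]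
    have h3 : singletonInterval τ (τ i) = e (singletonInterval σ (σ i)) := (he i).symm
    rw [h3]
    exact (e.le_iff_le (x := singletonInterval σ (σ i)) (y := blockInterval hcd)).trans
      singletonInterval_le_iff
  obtain ⟨c', d', hcd', hJ'⟩ := (nonempty_isInterval_iff τ J.1).1 J.2
  have heq : blockSet τ c d = blockSet τ c' d' := by
    rw [← hJ']
    exact ext_apply (σ := τ) fun i => by rw [hJ, apply_mem_blockSet]
  obtain ⟨h3, h4, -⟩ := mem_blockFamily.1 hcd'
  have h5 := (blockSet_mono_iff h1 h2).1 heq.subset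
  have h6 := (blockSet_mono_iff h3 h4).1 heq.superset
  obtain rfl : c = c' := by omega
  obtain rfl : d = d' := by omega
  exact hcd'

theorem nonempty_isInterval_map {n : ℕ} {σ τ : Equiv.Perm (Fin n)}
    (h : blockFamily n (permSeq σ) = blockFamily n (permSeq τ)) {I : Finset (Fin n)}
    (hI : I.Nonempty ∧ IsInterval σ I) :
    (I.map (σ.symm.trans τ).toEmbedding).Nonempty ∧
      IsInterval τ (I.map (σ.symm.trans τ).toEmbedding) := by
  obtain ⟨c, d, hcd, rfl⟩ := (nonempty_isInterval_iff σ I).1 hI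
  refine (nonempty_isInterval_iff τ _).2 ⟨c, d, h ▸ hcd, ext_apply (σ := τ) fun i => ?_⟩
  rw [apply_mem_blockSet, Finset.mem_map_equiv, Equiv.symm_trans_apply, Equiv.symm_apply_apply,
    Equiv.symm_symm, apply_mem_blockSet]

/-- Order isomorphisms of interval posets induced by a permutation of the values. -/
def mapIntervals {n : ℕ} {σ τ : Equiv.Perm (Fin n)} (f : Equiv.Perm (Fin n))
    (h : ∀ I, I.Nonempty ∧ IsInterval σ I →
      (I.map f.toEmbedding).Nonempty ∧ IsInterval τ (I.map f.toEmbedding))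
    (h' : ∀ I, I.Nonempty ∧ IsInterval τ I →
      (I.map f.symm.toEmbedding).Nonempty ∧ IsInterval σ (I.map f.symm.toEmbedding)) :
    NonemptyInterval σ ≃o NonemptyInterval τ where
  toFun I := ⟨I.1.map f.toEmbedding, h I.1 I.2⟩
  invFun I := ⟨I.1.map f.symm.toEmbedding, h' I.1 I.2⟩
  left_inv I := Subtype.ext (by ext; simp)
  right_inv I := Subtype.ext (by ext; simp)
  map_rel_iff' {I J} := Finset.map_subset_map

theorem same_iff {n : ℕ} (σ τ : Equiv.Perm (Fin n)) :
    (modifiedIntervalPoset σ).Same (modifiedIntervalPoset τ) ↔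
      blockFamily n (permSeq σ) = blockFamily n (permSeq τ) := by
  constructor
  · intro h
    exact (blockFamily_subset_of_same h).antisymm
      (blockFamily_subset_of_same ((PlanePoset.setoid n).symm h))
  · intro h
    refine ⟨mapIntervals (σ.symm.trans τ) (fun I => nonempty_isInterval_map h)
      (fun I => nonempty_isInterval_map h.symm), fun i => Subtype.ext ?_⟩
    change ({σ i} : Finset (Fin n)).map (σ.symm.trans τ).toEmbedding = {τ i}
    simp

/-- Inversion exchanges the roles of positions and values, which are symmetric in the definition of
an interval. -/
theorem isInterval_symm {n : ℕ} {σ : Equiv.Perm (Fin n)} {I : Finset (Fin n)}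
    (hI : I.Nonempty ∧ IsInterval σ I) :
    (I.map σ.symm.toEmbedding).Nonempty ∧ IsInterval σ.symm (I.map σ.symm.toEmbedding) := by
  obtain ⟨hne, ⟨a, b, hab⟩, c, d, hcd⟩ := hI
  refine ⟨hne.map, ⟨c, d, ?_⟩, a, b, by rw [hab]⟩
  rw [hcd]
  ext
  simp

/-- The original interval poset of a permutation is the modified one of its inverse. -/
theorem original_same_modified {n : ℕ} (σ : Equiv.Perm (Fin n)) :
    (originalIntervalPoset σ).Same (modifiedIntervalPoset σ.symm) := by
  refine ⟨mapIntervals σ.symm (fun I => isInterval_symm) (fun I => isInterval_symm),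
    fun i => Subtype.ext ?_⟩
  change ({i} : Finset (Fin n)).map σ.symm.toEmbedding = {σ.symm i}
  simp

theorem PlanePoset.Same.isTree {n : ℕ} {P Q : PlanePoset n} (h : P.Same Q) (hP : P.IsTree) :
    Q.IsTree := by
  obtain ⟨e, -⟩ := h
  have f : SimpleGraph.hasse P.carrier ≃g SimpleGraph.hasse Q.carrier :=
    { toEquiv := e.toEquiv
      map_rel_iff' := fun {x y} => by
        simp only [SimpleGraph.hasse_adj]
        exact or_congr (apply_covBy_apply_iff e) (apply_covBy_apply_iff e) }
  exact f.isTree_iff.1 hP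

theorem originalTreeIntervalPosets_eq (n : ℕ) :
    originalTreeIntervalPosets n = treeIntervalPosets n := by
  ext q
  constructor
  · rintro ⟨σ, hσ, rfl⟩
    exact ⟨σ.symm, (original_same_modified σ).isTree hσ, Quotient.sound (original_same_modified σ)⟩
  · rintro ⟨σ, hσ, rfl⟩
    have h := (PlanePoset.setoid n).symm (original_same_modified σ.symm)
    rw [Equiv.symm_symm] at h
    exact ⟨σ.symm, PlanePoset.Same.isTree h hσ, Quotient.sound h⟩

/-! ### The bijection between tree interval posets and plane trees. -/

theorem exists_perm_of_planeForest {n : ℕ} {s : List ℕ} {F : Finset (ℕ × ℕ)}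
    (h : PlaneForest s F n) (hs : s.length = 1) :
    ∃ σ : Equiv.Perm (Fin n), blockFamily n (permSeq σ) = F := by
  obtain ⟨b, rfl⟩ := List.length_eq_one_iff.1 hs
  obtain rfl : b = 0 := by simpa using h.getLast_starts
  obtain ⟨v, hv⟩ := (List.isChain_cons_cons.1 h.isChain_realizes).1
  obtain ⟨σ, hσ⟩ := exists_perm hv.inj
  exact ⟨σ, hσ.trans (hv.eq_blockFamily h.bounds.2).symm⟩

theorem planeForest_of_laminar {n : ℕ} (hn : 1 ≤ n) (σ : Equiv.Perm (Fin n))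
    (h : ∀ c d c' d', (c, d) ∈ blockFamily n (permSeq σ) →
      (c', d') ∈ blockFamily n (permSeq σ) → c < c' → c' < d → d' ≤ d) :
    ∃ s, PlaneForest s (blockFamily n (permSeq σ)) n ∧ s.length = 1 := by
  obtain ⟨s, F, hF, hR⟩ := exists_planeForest n (fun c d => (c, d) ∈ blockFamily n (permSeq σ))
    (fun c d h => (mem_blockFamily.1 h).1)
    (fun c hc => singleton_mem_blockFamily (permSeq_injOn σ) hc) h
    (fun c e f d hd h1 h2 h3 => blockFamily_three (permSeq_injOn σ) hd h1 h2 h3)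
  obtain rfl : F = blockFamily n (permSeq σ) := by
    ext ⟨c, d⟩
    rw [hR]
    exact and_iff_left_of_imp fun h => (mem_blockFamily.1 h).2.1
  -- The block `[0, n)` of all positions straddles every other candidate start, so there is only one
  -- tree.
  have hs : ∀ b ∈ s, b = 0 := by
    intro b hb
    have h1 := hF.lt_of_mem_starts hb
    have h2 := hF.le_or_le_of_mem b hb 0 n (univ_mem_blockFamily hn)
    omega
  refine ⟨s, hF, ?_⟩
  match s, hF, hs with
  | [], hF, _ =>
    have := hF.getLast_starts
    simp only [List.getLast_singleton] at this
    omega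
  | [_], _, _ => rfl
  | b :: b' :: _, hF, hs =>
    have h1 := List.rel_of_pairwise_cons hF.pairwise_starts (a' := b') (by simp)
    rw [hs b (by simp), hs b' (by simp)] at h1
    omega

/-- The tree interval posets are counted by the plane trees in which every internal node has two or
at least four children. -/
theorem ncard_treeIntervalPosets {n : ℕ} (hn : 1 ≤ n) :
    (treeIntervalPosets n).ncard = (planeForests 1 n).ncard := by
  symm
  choose! σ hσ using fun (p : List ℕ × Finset (ℕ × ℕ)) (hp : p ∈ planeForests 1 n) =>
    exists_perm_of_planeForest hp.1 hp.2
  refine Set.ncard_congr (fun p _ => (⟦modifiedIntervalPoset (σ p)⟧ : Quotient _)) ?_ ?_ ?_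
  · intro p hp
    refine ⟨σ p, (isTree_iff_laminar hn _).2 ?_, rfl⟩
    rw [hσ p hp]
    exact hp.1.laminar
  · intro p q hp hq h
    have h1 := (same_iff _ _).1 (Quotient.exact h)
    rw [hσ p hp, hσ q hq] at h1
    have h2 := hp.1
    rw [h1] at h2
    exact Prod.ext (h2.starts_unique hq.1) h1
  · rintro q ⟨τ, hτ, rfl⟩
    obtain ⟨s, h1, h2⟩ := planeForest_of_laminar hn τ ((isTree_iff_laminar hn τ).1 hτ)
    have hp : (s, blockFamily n (permSeq τ)) ∈ planeForests 1 n := ⟨h1, h2⟩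
    exact ⟨_, hp, Quotient.sound ((same_iff _ _).2 (hσ _ hp))⟩

/-! ### Solving the recurrence by Lagrange inversion. -/

open PowerSeries

/-- The generating function of the arities, shifted by one. -/
noncomputable def aritySeries : ℚ⟦X⟧ := PowerSeries.mk fun e => if IsArity (e + 1) then 1 else 0

theorem coeff_aritySeries (e : ℕ) :
    coeff e aritySeries = if IsArity (e + 1) then 1 else 0 := by
  rw [aritySeries, coeff_mk]

theorem constantCoeff_aritySeries : constantCoeff aritySeries = 0 := by
  rw [← coeff_zero_eq_constantCoeff_apply, coeff_aritySeries, if_neg (by decide)]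

/-- The inverse of `1 - aritySeries`. -/
noncomputable def lagrangeSeries : ℚ⟦X⟧ := (1 - aritySeries)⁻¹

theorem constantCoeff_one_sub_aritySeries : constantCoeff (1 - aritySeries) = 1 := by
  rw [map_sub, constantCoeff_aritySeries, map_one, sub_zero]

theorem lagrangeSeries_mul : lagrangeSeries * (1 - aritySeries) = 1 :=
  PowerSeries.inv_mul_cancel _ (by rw [constantCoeff_one_sub_aritySeries]; exact one_ne_zero)

theorem lagrangeSeries_pow_succ_mul (n : ℕ) :
    aritySeries * lagrangeSeries ^ (n + 1) = lagrangeSeries ^ (n + 1) - lagrangeSeries ^ n := by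
  have h : lagrangeSeries ^ (n + 1) * (1 - aritySeries) = lagrangeSeries ^ n := by
    rw [pow_succ, mul_assoc, lagrangeSeries_mul, mul_one]
  rw [← h]
  ring

theorem derivative_lagrangeSeries_pow (n : ℕ) :
    d⁄dX ℚ (lagrangeSeries ^ n) = n * (lagrangeSeries ^ (n + 1) * d⁄dX ℚ aritySeries) := by
  rw [derivative_pow, lagrangeSeries, derivative_inv', map_sub, derivative_one, zero_sub]
  rcases n with _ | n
  · simp
  · rw [Nat.add_sub_cancel]
    ring

theorem coeff_X_mul_derivative (f : ℚ⟦X⟧) (e : ℕ) : coeff e (X * d⁄dX ℚ f) = e * coeff e f := by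
  rcases e with _ | e
  · simp
  · rw [coeff_succ_X_mul, coeff_derivative]
    push_cast
    ring

/-- With `A` and `L` for `aritySeries` and `lagrangeSeries`, the weight `m + 1 + e` is split. The
constant part is summed by `A * L ^ (n + 1) = L ^ (n + 1) - L ^ n`, the part `e` by `X * (L ^ n)' =
n * X * A' * L ^ (n + 1)`. -/
theorem sum_arity_coeff (m n N : ℕ) :
    (n : ℚ) * ∑ e ∈ Finset.range (N + 1), (if IsArity (e + 1) then
      ((m + 1 + e : ℕ) : ℚ) * coeff (N - e) (lagrangeSeries ^ (n + 1)) else 0) =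
    n * (m + 1) * (coeff N (lagrangeSeries ^ (n + 1)) - coeff N (lagrangeSeries ^ n)) +
      N * coeff N (lagrangeSeries ^ n) := by
  have h1 : coeff N (lagrangeSeries ^ (n + 1)) - coeff N (lagrangeSeries ^ n) =
      ∑ e ∈ Finset.range (N + 1),
        coeff e aritySeries * coeff (N - e) (lagrangeSeries ^ (n + 1)) := by
    rw [← map_sub, ← lagrangeSeries_pow_succ_mul, coeff_mul,
      Finset.Nat.sum_antidiagonal_eq_sum_range_succ_mk]
  have h2 : N * coeff N (lagrangeSeries ^ n) = n * ∑ e ∈ Finset.range (N + 1),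
        (e * coeff e aritySeries) * coeff (N - e) (lagrangeSeries ^ (n + 1)) := by
    have h3 : X * d⁄dX ℚ (lagrangeSeries ^ n) =
        C (n : ℚ) * ((X * d⁄dX ℚ aritySeries) * lagrangeSeries ^ (n + 1)) := by
      rw [derivative_lagrangeSeries_pow, map_natCast]
      ring
    rw [← coeff_X_mul_derivative, h3, coeff_C_mul, coeff_mul,
      Finset.Nat.sum_antidiagonal_eq_sum_range_succ_mk]
    simp only [coeff_X_mul_derivative]
  rw [h1, h2, mul_assoc, Finset.mul_sum (a := (m : ℚ) + 1), ← mul_add, ← Finset.sum_add_distrib]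
  congr 1
  refine Finset.sum_congr rfl fun e _ => ?_
  rw [coeff_aritySeries]
  split_ifs
  · push_cast
    ring
  · ring

theorem sum_ncard_planeForests (m n N : ℕ) (h : m + N = n) :
    ∑ a ∈ Finset.range (n + 2) with IsArity a, (planeForests (m + a) (n + 1)).ncard =
      ∑ e ∈ Finset.range (N + 1), if IsArity (e + 1) then
        (planeForests (m + e + 1) (n + 1)).ncard else 0 := by
  rw [Finset.sum_filter, Finset.sum_range_succ', if_neg (by decide), add_zero]
  symm
  refine Finset.sum_subset (Finset.range_mono (by omega)) fun e _ he => ?_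
  rw [Finset.mem_range] at he
  split_ifs
  · rw [planeForests_eq_empty (by omega), Set.ncard_empty]
  · rfl

/-- The number of plane forests, in the form given by Lagrange inversion. -/
theorem ncard_planeForests (n : ℕ) : ∀ N m, m + N = n →
    ((n + 1 : ℕ) : ℚ) * (planeForests (m + 1) (n + 1)).ncard =
      ((m + 1 : ℕ) : ℚ) * coeff N (lagrangeSeries ^ (n + 1)) := by
  induction n with
  | zero =>
    intro N m h
    obtain ⟨rfl, rfl⟩ : m = 0 ∧ N = 0 := by omega
    rw [ncard_planeForests_succ_succ, planeForests_zero_zero, Set.ncard_singleton,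
      Finset.sum_eq_zero]
    · have := constantCoeff_one_sub_aritySeries
      simp [lagrangeSeries, this, -map_sub]
    · intro a ha
      rw [Finset.mem_filter, Finset.mem_range] at ha
      have := ha.2.two_le
      omega
  | succ n ih =>
    intro N
    -- `N` is the excess of leaves over trees. Before joining `e + 1` trees the excess is `N - e`,
    -- which is smaller because arities are at least two.
    induction N using Nat.strong_induction_on with
    | _ N ihN =>
      intro m h
      have hprev : ((n + 1 : ℕ) : ℚ) * (planeForests m (n + 1)).ncard =
          m * coeff N (lagrangeSeries ^ (n + 1)) := by
        rcases m with _ | m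
        · simp [planeForests_zero_succ]
        · exact ih N m (by omega)
      have hsum := sum_arity_coeff m (n + 1) N
      have hterms : ((n + 1 + 1 : ℕ) : ℚ) * ((∑ a ∈ Finset.range (n + 1 + 2) with IsArity a,
          (planeForests (m + a) (n + 1 + 1)).ncard : ℕ) : ℚ) =
          ∑ e ∈ Finset.range (N + 1), (if IsArity (e + 1) then
            ((m + 1 + e : ℕ) : ℚ) * coeff (N - e) (lagrangeSeries ^ (n + 1 + 1)) else 0) := by
        rw [sum_ncard_planeForests m (n + 1) N h, Nat.cast_sum, Finset.mul_sum]
        refine Finset.sum_congr rfl fun e he => ?_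
        rw [Finset.mem_range] at he
        split_ifs with ha
        · have := ha.two_le
          rw [ihN (N - e) (by omega) (m + e) (by omega), Nat.add_right_comm]
        · simp
      rw [ncard_planeForests_succ_succ, Nat.cast_add (planeForests m (n + 1)).ncard, mul_add, hterms]
      have hne : ((n + 1 : ℕ) : ℚ) ≠ 0 := by positivity
      apply mul_left_cancel₀ hne
      rw [mul_add, hsum, mul_left_comm, hprev]
      -- This relation makes the coefficients of `lagrangeSeries ^ (n + 1)` cancel and leaves only
      -- those of the next power.
      have hN : (n : ℚ) + 1 = m + N := by exact_mod_cast h.symm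
      push_cast
      rw [hN]
      ring

/-! ### Extracting the closed formula. -/

theorem lagrangeSeries_pow_eq_subst (d : ℕ) : lagrangeSeries ^ (d + 1) =
    (PowerSeries.mk fun i => ((d + i).choose d : ℚ)).subst aritySeries := by
  have hA : HasSubst aritySeries := HasSubst.of_constantCoeff_zero' constantCoeff_aritySeries
  have h := congrArg (substAlgHom (R := ℚ) hA)
    (mk_add_choose_mul_one_sub_pow_eq_one (S := ℚ) (d := d))
  rw [map_mul, map_pow, map_sub, map_one, substAlgHom_X, coe_substAlgHom] at h
  have h' : (1 - aritySeries) ^ (d + 1) * lagrangeSeries ^ (d + 1) = 1 := by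
    rw [← mul_pow, mul_comm, lagrangeSeries_mul, one_pow]
  exact (left_inv_eq_right_inv h h').symm

theorem aritySeries_eq : aritySeries = X * (1 + X ^ 2 * PowerSeries.mk 1) := by
  ext e
  rw [coeff_aritySeries]
  rcases e with _ | e
  · rw [if_neg (by decide)]
    simp
  · rw [coeff_succ_X_mul, map_add, coeff_one, coeff_X_pow_mul']
    simp only [IsArity, coeff_mk, Pi.one_apply]
    rcases e with _ | _ | e <;> norm_num

theorem coeff_X_sq_mul_mk_one_pow (M k : ℕ) (hk : 1 ≤ k) :
    coeff M ((X ^ 2 * PowerSeries.mk 1 : ℚ⟦X⟧) ^ k) =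
      if 2 * k ≤ M then ((M - k - 1).choose (k - 1) : ℚ) else 0 := by
  obtain ⟨k, rfl⟩ : ∃ j, k = j + 1 := ⟨k - 1, by omega⟩
  rw [mul_pow, ← pow_mul, coeff_X_pow_mul', mk_one_pow_eq_mk_choose_add, coeff_mk]
  split_ifs with h
  · rw [show k + (M - 2 * (k + 1)) = M - (k + 1) - 1 by omega, Nat.add_sub_cancel]
  · rfl

/-- Binomial expansion of `X ^ i * (1 + X ^ 2 / (1 - X)) ^ i`: the index `k` counts the factors that
contribute `X ^ 2 / (1 - X)`, and `k = 0` gives the separate term. -/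
theorem coeff_aritySeries_pow {d i : ℕ} (hi : i ≤ d) : coeff d (aritySeries ^ i) =
    (if i = d then 1 else 0) + ∑ k ∈ Finset.Icc 1 (min i ((d - i) / 2)),
      (i.choose k : ℚ) * ((d - i - k - 1).choose (k - 1) : ℚ) := by
  rw [aritySeries_eq, mul_pow, coeff_X_pow_mul', if_pos hi, add_comm (1 : ℚ⟦X⟧), add_pow, map_sum,
    Finset.sum_range_succ', add_comm]
  congr 1
  · simp only [pow_zero, one_pow, mul_one, Nat.choose_zero_right, Nat.cast_one, coeff_one]
    exact if_congr (by omega) rfl rfl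
  · rw [Finset.range_eq_Ico, Finset.sum_Ico_add' (fun k => coeff (d - i)
      ((X ^ 2 * PowerSeries.mk 1 : ℚ⟦X⟧) ^ k * 1 ^ (i - k) * (i.choose k : ℚ⟦X⟧))) 0 i 1]
    symm
    have hterm : ∀ k, 1 ≤ k → coeff (d - i)
        ((X ^ 2 * PowerSeries.mk 1 : ℚ⟦X⟧) ^ k * 1 ^ (i - k) * (i.choose k : ℚ⟦X⟧)) =
        if 2 * k ≤ d - i then (i.choose k : ℚ) * ((d - i - k - 1).choose (k - 1) : ℚ) else 0 := by
      intro k hk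
      rw [one_pow, mul_one, mul_comm, ← map_natCast (C (R := ℚ)), coeff_C_mul,
        coeff_X_sq_mul_mk_one_pow _ _ hk, mul_ite, mul_zero]
    refine (Finset.sum_congr rfl fun k hk => ?_).trans (Finset.sum_subset ?_ fun k hk hk' => ?_)
    · rw [Finset.mem_Icc] at hk
      rw [hterm k hk.1, if_pos (by omega)]
    · intro k hk
      rw [Finset.mem_Icc] at hk
      rw [Finset.mem_Ico]
      omega
    · rw [Finset.mem_Ico] at hk
      rw [Finset.mem_Icc] at hk'
      rw [hterm k (by omega), if_neg (by omega)]

theorem coeff_lagrangeSeries_pow (d : ℕ) : coeff d (lagrangeSeries ^ (d + 1)) =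
    ∑ i ∈ Finset.range (d + 1), ((d + i).choose d : ℚ) * coeff d (aritySeries ^ i) := by
  have hA : HasSubst aritySeries := HasSubst.of_constantCoeff_zero' constantCoeff_aritySeries
  rw [lagrangeSeries_pow_eq_subst, coeff_subst' hA,
    finsum_eq_sum_of_support_subset (s := Finset.range (d + 1))]
  · simp only [coeff_mk, smul_eq_mul]
  · intro i hi
    by_contra hlt
    rw [Finset.coe_range, Set.mem_Iio, not_lt] at hlt
    refine hi ?_
    beta_reduce
    rw [aritySeries_eq, mul_pow, coeff_X_pow_mul', if_neg (by omega), smul_zero]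

theorem coeff_lagrangeSeries_pow_eq (d : ℕ) (hd : 1 ≤ d) :
    coeff d (lagrangeSeries ^ (d + 1)) =
      (∑ i ∈ Finset.Icc 1 (d - 2), ∑ k ∈ Finset.Icc 1 (min i ((d - i) / 2)),
        ((d + i).choose i : ℚ) * (i.choose k : ℚ) * ((d - i - k - 1).choose (k - 1) : ℚ)) +
      ((2 * d).choose d : ℚ) := by
  have hi : ∀ i ∈ Finset.range (d + 1), ((d + i).choose d : ℚ) * coeff d (aritySeries ^ i) =
      (if i = d then ((2 * d).choose d : ℚ) else 0) +
        ∑ k ∈ Finset.Icc 1 (min i ((d - i) / 2)),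
          ((d + i).choose i : ℚ) * (i.choose k : ℚ) * ((d - i - k - 1).choose (k - 1) : ℚ) := by
    intro i hi
    rw [Finset.mem_range] at hi
    rw [coeff_aritySeries_pow (by omega), mul_add, Finset.mul_sum, Nat.choose_symm_add]
    congr 1
    · split_ifs with h
      · rw [h, two_mul, mul_one]
      · rw [mul_zero]
    · exact Finset.sum_congr rfl fun k _ => (mul_assoc _ _ _).symm
  rw [coeff_lagrangeSeries_pow, Finset.sum_congr rfl hi, Finset.sum_add_distrib,
    Finset.sum_ite_eq', if_pos (by simp), add_comm]
  congr 1
  symm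
  refine Finset.sum_subset (fun i hi => ?_) fun i hi hi' => ?_
  · rw [Finset.mem_Icc] at hi
    rw [Finset.mem_range]
    omega
  · rw [Finset.mem_range] at hi
    rw [Finset.mem_Icc] at hi'
    -- The omitted indices are `0`, `d - 1` and `d`, for which the bound on `k` is zero.
    rw [Finset.Icc_eq_empty (by omega), Finset.sum_empty]

theorem ncard_planeForests_one {n : ℕ} (hn : 1 ≤ n) :
    ((planeForests 1 n).ncard : ℚ) = treeFormula n := by
  obtain ⟨d, rfl⟩ : ∃ d, n = d + 1 := ⟨n - 1, by omega⟩
  have h := ncard_planeForests d d 0 (zero_add d)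
  have hne : ((d + 1 : ℕ) : ℚ) ≠ 0 := by positivity
  rw [zero_add, Nat.cast_one, one_mul] at h
  rw [treeFormula]
  split_ifs with h1
  · obtain rfl : d = 0 := by omega
    have h2 := constantCoeff_one_sub_aritySeries
    simpa [lagrangeSeries, h2, -map_sub] using h
  · rw [one_div, eq_inv_mul_iff_mul_eq₀ hne, h, coeff_lagrangeSeries_pow_eq d (by omega)]
    congr 1
    · refine Finset.sum_congr rfl fun i hi => ?_
      rw [show d + 1 - i - 1 = d - i by omega]
      refine Finset.sum_congr rfl fun k hk => ?_
      rw [show d + 1 + i - 1 = d + i by omega, show d + 1 - i - k - 2 = d - i - k - 1 by omega]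

end IntervalPosets

theorem mainTheorem7 (n : ℕ) (hn : 1 ≤ n) :
    ((IntervalPosets.treeIntervalPosets n).ncard : ℚ) = IntervalPosets.treeFormula n ∧
      ((IntervalPosets.originalTreeIntervalPosets n).ncard : ℚ) =
        IntervalPosets.treeFormula n := by
  rw [IntervalPosets.originalTreeIntervalPosets_eq, and_self,
    IntervalPosets.ncard_treeIntervalPosets hn]
  exact IntervalPosets.ncard_planeForests_one hn
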